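/- **Theorem (Block-encoding of two-level Additive Schwarz with BPX local solvers).** For every dimension $d\ge 1$ there is a constant $C_d$, depending only on $d$, such that the following holds. *Geometry.* Let $L\ge 1$, let $N_1,\dots,N_d\ge 1$, $N=\prod_s N_s$, and let $0<2\delta<1$ with $2\delta/2^{-L}$ an integer. Let $\Omega=\prod_{s=1}^d[0,\,N_s-2\delta(N_s-1)]$, with its Cartesian mesh $\mathcal T_L$ of mesh size $2^{-L}$, and let $\Omega^{(i)}$, $i=(i_1,\dots,i_d)$ with $0\le i_s<N_s$, be the $N$ unit cubes $\prod_s\big(i_s(1-2\delta),\,i_s(1-2\delta)+1\big)$. Let $V_L$ be the $\mathbb Q_1$ finite element space on $\mathcal T_L$ with zero boundary values and $(\phi_v)$ its nodal basis, indexed by the $\mathcal N$ interior vertices. *Matrices.* Let $\rho$ be a diffusion coefficient with values in the symmetric positive definite $d\times d$ matrices on every element $K\in\mathcal T_L$, equal to a constant $\rho_{|K}$ there. Put $A_{vw}=\int_\Omega\rho\,\nabla\phi_v\cdot\nabla\phi_w$, and let $D_\rho$ be the block-diagonal matrix with the blocks $\rho_{|K}$. Let $C_L$ be the matrix of the elementwise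 gradient from $V_L$, with its nodal basis, into $Q_L\otimes\mathbb R^d$, where $Q_L$ is the discontinuous piecewise $\mathbb Q_1$ space on $\mathcal T_L$ and $Q_L\otimes\mathbb R^d$ carries the basis $\psi_{K,k}\otimes e_s$; here $\psi_{K,1},\dots,\psi_{K,2^d}$ is an $L^2$-orthonormal basis of $\mathbb Q_1(K)$ for each $K$, and $e_s$ are the unit vectors of $\mathbb R^d$. Let $R_L^{(i)}$ consist of the rows of $I_{\mathcal N}$ that belong to the interior vertices of $\Omega^{(i)}$. *Preconditioner.* In each subdomain use the BPX factor $$F^{(i)}=\big(2^{-(2-d)/2}\mathcal I_{1,L}\,|\,\cdots\,|\,2^{-l(2-d)/2}\mathcal I_{l,L}\,|\,\cdots\,|\,2^{-L(2-d)/2}\mathcal I_{L,L}\big),$$ where $\mathcal I_{l,L}$ is the matrix, in the nodal bases, of the embedding $V_l^{(i)}\hookrightarrow V_L^{(i)}$ of the $\mathbb Q_1$ spaces with zero boundary values on the Cartesian meshes of $\Omega^{(i)}$ of sizes $2^{-l}$ and $2^{-L}$. Let $Z$ be a real matrix with $\mathcal N$ rows and at least one column, whose columns are linearly independent (a basis of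 the coarse space), let $F^{(0)}$ be a real, possibly rectangular, matrix with $(Z^\top AZ)^{-1}=F^{(0)}{F^{(0)}}^\top$, and let $$\tilde F=\big({R_L^{(1)}}^\top F^{(1)}\,|\,\cdots\,|\,{R_L^{(N)}}^\top F^{(N)}\,|\,ZF^{(0)}\big).$$ *Block-encodings.* A block-encoding $U_{\mathcal A}$ of $\mathcal A\in\mathbb C^{M_1\times M_2}$ consists of a unitary $U\in\mathbb C^{2^p\times 2^p}$, matrices $\Pi_{M_j}\in\mathbb C^{M_j\times 2^p}$ ($j=1,2$) with orthonormal rows, together with the gates $\Pi_{M_j}^\dagger\Pi_{M_j}\otimes X+(I-\Pi_{M_j}^\dagger\Pi_{M_j})\otimes I$, and a normalization factor $\alpha(U_{\mathcal A})\ge\|\mathcal A\|$ with $\mathcal A=\alpha(U_{\mathcal A})\,\Pi_{M_1}U\,\Pi_{M_2}^\dagger$. Its subnormalization factor is $\tilde\alpha(U_{\mathcal A})=\alpha(U_{\mathcal A})/\|\mathcal A\|$. Here $\|\cdot\|$ is the spectral norm, and $\kappa(D_\rho)=\|D_\rho\|\,\|D_\rho^{-1}\|$. *Claim.* For every block-encoding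 $U_{D_\rho}$ of $D_\rho$ and every block-encoding $U_{C_LZF^{(0)}}$ of $C_LZF^{(0)}$ there exists a block-encoding $U_{\tilde F^\top A\tilde F}$ of $\tilde F^\top A\tilde F$ with normalization factor $$\alpha(U_{\tilde F^\top A\tilde F})=\alpha(U_{D_\rho})\left(4NdL+\alpha\big(U_{C_LZF^{(0)}}\big)^2\right)$$ and subnormalization factor $$\tilde\alpha(U_{\tilde F^\top A\tilde F})\le\kappa(D_\rho)\,\tilde\alpha(U_{D_\rho})\left(Nd(L+C_d)+\tilde\alpha\big(U_{C_LZF^{(0)}}\big)^2\right).$$ -/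

import Mathlib

open scoped Matrix Matrix.Norms.L2Operator Kronecker
open MeasureTheory

noncomputable section

/-! ### Block-encodings -/

/-- The gate `C_Π NOT = Π† Π ⊗ X + (1 - Π† Π) ⊗ 1` of a matrix `Π` with orthonormal rows. -/
def projNOT {m P : Type*} [Fintype m] [DecidableEq P] (Pi : Matrix m P ℂ) :
    Matrix (P × Fin 2) (P × Fin 2) ℂ :=
  (Piᴴ * Pi) ⊗ₖ !![0, 1; 1, 0] + (1 - Piᴴ * Pi) ⊗ₖ (1 : Matrix (Fin 2) (Fin 2) ℂ)

/-- A block-encoding of the rectangular matrix `M` (also known as a projected unitary encoding):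
a unitary `U` of order `2 ^ p`, two matrices with orthonormal rows and their controlled-NOT gates,
and a normalization factor `α ≥ ‖M‖` such that `M = α Π₁ U Π₂†`. The norm is the spectral norm. -/
structure BlockEncoding {m n : Type*} [Fintype m] [DecidableEq m] [Fintype n] [DecidableEq n]
    (M : Matrix m n ℂ) where
  /-- the number of qubits -/
  p : ℕ
  /-- the encoding matrix -/
  U : Matrix (Fin (2 ^ p)) (Fin (2 ^ p)) ℂ
  /-- the normalization factor -/
  α : ℝ
  /-- the row projection -/
  rowProj : Matrix m (Fin (2 ^ p)) ℂ
  /-- the column projection -/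
  colProj : Matrix n (Fin (2 ^ p)) ℂ
  /-- the gate that implements the row projection -/
  rowNOT : Matrix (Fin (2 ^ p) × Fin 2) (Fin (2 ^ p) × Fin 2) ℂ
  /-- the gate that implements the column projection -/
  colNOT : Matrix (Fin (2 ^ p) × Fin 2) (Fin (2 ^ p) × Fin 2) ℂ
  unitary : U ∈ Matrix.unitaryGroup (Fin (2 ^ p)) ℂ
  rowProj_orthonormal : rowProj * rowProjᴴ = 1
  colProj_orthonormal : colProj * colProjᴴ = 1
  rowNOT_eq : rowNOT = projNOT rowProj
  colNOT_eq : colNOT = projNOT colProj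
  norm_le : ‖M‖ ≤ α
  encodes : M = (α : ℂ) • (rowProj * U * colProjᴴ)

/-- The subnormalization factor `α / ‖M‖` of a block-encoding of `M`. -/
def BlockEncoding.subnorm {m n : Type*} [Fintype m] [DecidableEq m] [Fintype n] [DecidableEq n]
    {M : Matrix m n ℂ} (E : BlockEncoding M) : ℝ :=
  E.α / ‖M‖

/-- A real matrix seen as a complex matrix. -/
def toC {m n : Type*} (M : Matrix m n ℝ) : Matrix m n ℂ := M.map Complex.ofReal

/-- The spectral condition number of a nonsingular matrix. -/
def condNumber {n : Type*} [Fintype n] [DecidableEq n] (M : Matrix n n ℂ) : ℝ :=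
  ‖M‖ * ‖M⁻¹‖

/-! ### Finite elements on Cartesian grids -/

/-- The one-dimensional hat function. -/
def hat (t : ℝ) : ℝ := max 0 (1 - |t|)

/-- The `d`-linear nodal function, on the grid of mesh size `2 ^ (-l)`, of the vertex `2 ^ (-l) c`:
it is continuous, `d`-linear on each mesh element, equal to 1 at this vertex and to 0 at all the
others. -/
def nodalFun {d : ℕ} (l : ℕ) (c : Fin d → ℕ) (x : Fin d → ℝ) : ℝ :=
  ∏ s, hat (2 ^ l * x s - c s)

/-- The gradient, through the partial derivatives. For the finite element functions it is
meaningful outside the (null) union of the element boundaries. -/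
def grad {d : ℕ} (f : (Fin d → ℝ) → ℝ) (x : Fin d → ℝ) : Fin d → ℝ :=
  fun s => lineDeriv ℝ f x (Pi.single s 1)

/-- The space `ℚ₁` spanned by the monomials of degree at most 1 in each variable. -/
def QOne (d : ℕ) : Submodule ℝ ((Fin d → ℝ) → ℝ) :=
  Submodule.span ℝ (Set.range fun (S : Finset (Fin d)) (x : Fin d → ℝ) => ∏ s ∈ S, x s)

/-! ### The BPX factor on the unit cube -/

/-- The interior vertices `2 ^ (-l) (w + 1)` of the grid of mesh size `2 ^ (-l)` of the unit
cube. -/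
abbrev CubeVertex (d l : ℕ) : Type := Fin d → Fin (2 ^ l - 1)

/-- The columns of the BPX factor: a level `l + 1` in `{1, …, L}` with an interior vertex of the
grid of this level. -/
abbrev BPXIndex (d L : ℕ) : Type := Σ l : Fin L, CubeVertex d (l + 1)

/-- The matrix, in the nodal bases, of the embedding of the finite element space of level `l` on
the unit cube (with zero boundary values) into the one of level `L`: its columns hold the values
of the nodal functions of level `l` at the interior vertices of level `L`. -/
def levelEmbedding (d l L : ℕ) : Matrix (CubeVertex d L) (CubeVertex d l) ℝ :=
  Matrix.of fun w j =>
    nodalFun l (fun s => (j s : ℕ) + 1) (fun s => ((w s : ℝ) + 1) / 2 ^ L)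

/-- The BPX factor `(2 ^ (-(2-d)/2) I_{1,L} | ⋯ | 2 ^ (-L(2-d)/2) I_{L,L})`. -/
def bpxFactor (d L : ℕ) : Matrix (CubeVertex d L) (BPXIndex d L) ℝ :=
  Matrix.of fun w c =>
    (2 : ℝ) ^ (-(((c.1 : ℕ) + 1 : ℕ) : ℝ) * (2 - (d : ℝ)) / 2) *
      levelEmbedding d (c.1 + 1) L w c.2

/-! ### The geometry of the domain decomposition -/

/-- A Cartesian family of overlapping unit cubes in dimension `d`: `N s` of them in direction `s`,
meshed with mesh size `2 ^ (-L)`, neighbours overlapping by `m = 2 δ / 2 ^ (-L)` elements. -/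
structure DDGeometry (d : ℕ) where
  L : ℕ
  N : Fin d → ℕ
  m : ℕ
  one_le_L : 1 ≤ L
  one_le_N : ∀ s, 1 ≤ N s
  m_pos : 0 < m
  m_lt : m < 2 ^ L

namespace DDGeometry

variable {d : ℕ} (G : DDGeometry d)

/-- The overlap parameter `δ`. -/
def δ : ℝ := (G.m : ℝ) / 2 / 2 ^ G.L

/-- The total number of subdomains. -/
def numSub : ℕ := ∏ s, G.N s

/-- The number of mesh elements of the domain in direction `s`. -/
def cells (s : Fin d) : ℕ := 2 ^ G.L + (G.N s - 1) * (2 ^ G.L - G.m)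

/-- The side lengths of the domain are `N s - 2 δ (N s - 1)`. -/
theorem cells_div (s : Fin d) :
    (G.cells s : ℝ) / 2 ^ G.L = G.N s - 2 * G.δ * (G.N s - 1) := by
  have h1 := G.one_le_N s
  have h2 := G.m_lt.le
  unfold cells δ
  push_cast [h1, h2]
  field_simp
  ring

/-- The domain. -/
def Ω : Set (Fin d → ℝ) :=
  Set.pi Set.univ fun s => Set.Icc 0 (G.N s - 2 * G.δ * (G.N s - 1))

/-- The interior vertices `2 ^ (-L) (v + 1)` of the mesh of the domain. -/
abbrev Vertex : Type := (s : Fin d) → Fin (G.cells s - 1)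

/-- The mesh elements. -/
abbrev Cell : Type := (s : Fin d) → Fin (G.cells s)

/-- The subdomains: `i` stands for the cube
`∏ s, (i s * (1 - 2 * δ), i s * (1 - 2 * δ) + 1)`. -/
abbrev Sub : Type := (s : Fin d) → Fin (G.N s)

/-- The (open) mesh element with index `K`. -/
def cellSet (K : G.Cell) : Set (Fin d → ℝ) :=
  Set.pi Set.univ fun s => Set.Ioo ((K s : ℝ) / 2 ^ G.L) (((K s : ℝ) + 1) / 2 ^ G.L)

/-- The nodal basis of the finite element space on the domain. -/
def φ (v : G.Vertex) : (Fin d → ℝ) → ℝ := nodalFun G.L fun s => (v s : ℕ) + 1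

/-- The stiffness matrix of the diffusion coefficient `ρ`. -/
def stiffness (ρ : (Fin d → ℝ) → Matrix (Fin d) (Fin d) ℝ) : Matrix G.Vertex G.Vertex ℝ :=
  Matrix.of fun v w => ∫ x in G.Ω, (ρ x *ᵥ grad (G.φ v) x) ⬝ᵥ grad (G.φ w) x

/-- The restrictions of `ψ K 0, …, ψ K (2 ^ d - 1)` to the element `K` form an `L²(K)`-orthonormal
basis of `ℚ₁(K)`, for every element `K`. -/
structure IsDGBasis (ψ : G.Cell → Fin (2 ^ d) → (Fin d → ℝ) → ℝ) : Prop where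
  span_eq : ∀ K, Submodule.span ℝ (Set.range (ψ K)) = QOne d
  orthonormal : ∀ K k k', ∫ x in G.cellSet K, ψ K k x * ψ K k' x = if k = k' then 1 else 0

/-- The matrix `C_L` of the elementwise gradient from the finite element space to the
`d`-vector-valued discontinuous `ℚ₁` space with the `L²`-orthonormal basis `ψ_{K,k} ⊗ e_s`:
its entries are the `L²` inner products of the gradients of the nodal functions with these basis
functions. Rows are indexed by `((s, K), k)`. -/
def gradMatrix (ψ : G.Cell → Fin (2 ^ d) → (Fin d → ℝ) → ℝ) :
    Matrix ((Fin d × G.Cell) × Fin (2 ^ d)) G.Vertex ℝ :=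
  Matrix.of fun r v => ∫ x in G.cellSet r.1.2, grad (G.φ v) x r.1.1 * ψ r.1.2 r.2 x

/-- The block-diagonal matrix `D_ρ`, with one block `ρK K` for each element `K`. -/
def coeffMatrix (ρK : G.Cell → Matrix (Fin d) (Fin d) ℝ) :
    Matrix (Fin d × G.Cell) (Fin d × G.Cell) ℝ :=
  Matrix.blockDiagonal ρK

theorem embed_lt (i : G.Sub) (w : CubeVertex d G.L) (s : Fin d) :
    (i s : ℕ) * (2 ^ G.L - G.m) + w s < G.cells s - 1 := by
  have h1 := (w s).2
  have h2 : (i s : ℕ) ≤ G.N s - 1 := by have := (i s).2; omega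
  have h3 := Nat.mul_le_mul_right (2 ^ G.L - G.m) h2
  unfold cells
  omega

/-- The interior vertex of the domain that is the interior vertex `w` of the subdomain `i`. -/
def embed (i : G.Sub) (w : CubeVertex d G.L) : G.Vertex :=
  fun s => ⟨(i s : ℕ) * (2 ^ G.L - G.m) + w s, G.embed_lt i w s⟩

/-- The restriction matrix of the subdomain `i`: the rows of the identity matrix that belong to
the interior vertices of this subdomain. -/
def restriction (i : G.Sub) : Matrix (CubeVertex d G.L) G.Vertex ℝ :=
  (1 : Matrix G.Vertex G.Vertex ℝ).submatrix (G.embed i) id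

/-- The factor `(R₁ᵀ F₁ | ⋯ | R_Nᵀ F_N | Z F₀)` of the two-level additive Schwarz preconditioner
with BPX local solvers. -/
def schwarzFactor {k q : ℕ} (Z : Matrix G.Vertex (Fin k) ℝ) (F₀ : Matrix (Fin k) (Fin q) ℝ) :
    Matrix G.Vertex ((G.Sub × BPXIndex d G.L) ⊕ Fin q) ℝ :=
  Matrix.fromCols
    (Matrix.of fun v c => ((G.restriction c.1)ᵀ * bpxFactor d G.L) v c.2)
    (Z * F₀)

end DDGeometry

end

/-! Write `C` for the elementwise gradient matrix, `D` for the coefficient matrix and `F` for the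
Schwarz factor. On each cell the gradient of a nodal function lies in `ℚ₁`, so Parseval for the
orthonormal basis turns the stiffness integral into the exact factorization `A = Cᵀ (D ⊗ 1) C`. With
`D = Bᵀ B` and `B` invertible, the matrix `M = Fᵀ A F` is `Yᵀ Y` for `Y = (B ⊗ 1) C F`. By the
C*-identity, `‖M‖ ≤ ‖D‖ ‖C F‖²` and `‖C F‖² ≤ ‖D⁻¹‖ ‖M‖`, and everything reduces to two-sided bounds
for `‖C F‖²`.

Upper bound: `‖C F‖²` is at most the sum of the squared norms of its local and coarse column blocks.
A local column is, up to a BPX weight, the gradient of a translated nodal function of level `l`. A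
Schur test, with row sums bounded pointwise (`sum_abs_pder_le`) and column sums bounded by
integration (`integral_abs_pder_le`), gives `4 N L` for each of the `d` partial derivatives; the BPX
weights make the bound the same on all levels (`levelWeight_sq`).

Lower bound: `‖C F‖` dominates the norm of each column block. For the local block, signs alternating
in one direction on the finest level of one subdomain make the slopes of neighbouring hats add up,
and the Rayleigh quotient is at least `4 (1 - 1/(2n))^d` with `n = 2^L - 1`, hence at least `4 L /
(L + 2^d)`. This form is chosen because `4 N d L` divided by it is `N d (L + 2^d)`, so that `C_d =
2^d`.

A block-encoding with a prescribed normalization `α ≥ ‖M‖` exists by unitary dilation of the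
Hermitian contraction `M / α`. The given encodings enter only through their normalization factors,
which bound the norms of the encoded matrices. -/

noncomputable section

/-! ### The hat function and its derivative -/

/-- The derivative of the hat function away from its three kinks, extended by zero. -/
def dhat (t : ℝ) : ℝ := if -1 < t ∧ t < 0 then 1 else if 0 < t ∧ t < 1 then -1 else 0

theorem hat_nonneg (t : ℝ) : 0 ≤ hat t := le_max_left _ _

theorem hat_of_one_le_abs {t : ℝ} (h : 1 ≤ |t|) : hat t = 0 := max_eq_left (by linarith)

theorem hat_of_abs_le_one {t : ℝ} (h : |t| ≤ 1) : hat t = 1 - |t| := max_eq_right (by linarith)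

theorem hat_zero : hat 0 = 1 := by simp [hat]

theorem continuous_hat : Continuous hat := by unfold hat; fun_prop

theorem hat_intCast (z : ℤ) : hat z = if z = 0 then 1 else 0 := by
  split_ifs with h
  · simp [h, hat_zero]
  · apply hat_of_one_le_abs
    exact_mod_cast Int.one_le_abs h

theorem measurable_dhat : Measurable dhat := by
  unfold dhat
  refine Measurable.ite (measurableSet_Ioo (a := (-1 : ℝ)) (b := 0)) measurable_const ?_
  exact Measurable.ite (measurableSet_Ioo (a := (0 : ℝ)) (b := 1)) measurable_const measurable_const

theorem hasDerivAt_hat {t : ℝ} (h0 : t ≠ 0) (h1 : t ≠ 1) (h2 : t ≠ -1) :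
    HasDerivAt hat (dhat t) t := by
  have key : ∀ (a b : ℝ) (s : Set ℝ), IsOpen s → t ∈ s → (∀ x ∈ s, hat x = a + b * x) →
      HasDerivAt hat b t := by
    intro a b s hs hts hx
    have : HasDerivAt (fun x : ℝ => a + b * x) b t := by
      simpa using ((hasDerivAt_id t).const_mul b).const_add a
    refine this.congr_of_eventuallyEq ?_
    filter_upwards [hs.mem_nhds hts] with x hxs using hx x hxs
  rcases lt_or_gt_of_ne h2 with h | h
  · have e : dhat t = 0 := by
      simp only [dhat]; rw [if_neg (by intro h'; linarith [h'.1]), if_neg (by intro h'; linarith [h'.1])]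
    rw [e]
    exact key 0 0 _ isOpen_Iio h fun x hx => by
      rw [hat_of_one_le_abs (le_abs.2 (Or.inr (by linarith [Set.mem_Iio.1 hx])))]; ring
  rcases lt_or_gt_of_ne h0 with h' | h'
  · rw [dhat, if_pos ⟨h, h'⟩]
    exact key 1 1 _ isOpen_Ioo ⟨h, h'⟩ fun x hx => by
      rw [hat_of_abs_le_one (abs_le.2 ⟨hx.1.le, by linarith [hx.2]⟩), abs_of_neg hx.2]; ring
  rcases lt_or_gt_of_ne h1 with h'' | h''
  · rw [dhat, if_neg (by intro h'; linarith [h'.2]), if_pos ⟨h', h''⟩]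
    exact key 1 (-1) _ isOpen_Ioo ⟨h', h''⟩ fun x hx => by
      rw [hat_of_abs_le_one (abs_le.2 ⟨by linarith [hx.1], hx.2.le⟩), abs_of_pos hx.1]; ring
  · have e : dhat t = 0 := by
      simp only [dhat]; rw [if_neg (by intro h'; linarith [h'.2]), if_neg (by intro h'; linarith [h'.2])]
    rw [e]
    exact key 0 0 _ isOpen_Ioi h'' fun x hx => by
      rw [hat_of_one_le_abs (le_abs.2 (Or.inl (by linarith [Set.mem_Ioi.1 hx])))]; ring

/-- The hat function is affine between consecutive integers. -/
theorem hat_convex_comb (k : ℤ) {a b t : ℝ} (ha : (k : ℝ) ≤ a) (hb : b ≤ k + 1)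
    (hta : a ≤ t) (htb : t ≤ b) :
    (b - a) * hat t = (b - t) * hat a + (t - a) * hat b := by
  -- The kinks are at -1, 0 and 1, so these are the four affine pieces.
  have hk : k ≤ -2 ∨ k = -1 ∨ k = 0 ∨ 1 ≤ k := by omega
  rcases hk with h | h | h | h
  · have h' : (k : ℝ) ≤ -2 := by exact_mod_cast h
    rw [hat_of_one_le_abs (le_abs.2 (Or.inr (by linarith : 1 ≤ -t))),
      hat_of_one_le_abs (le_abs.2 (Or.inr (by linarith : 1 ≤ -a))),
      hat_of_one_le_abs (le_abs.2 (Or.inr (by linarith : 1 ≤ -b)))]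
    ring
  · subst h
    push_cast at ha hb
    rw [hat_of_abs_le_one (abs_le.2 ⟨by linarith, by linarith⟩),
      hat_of_abs_le_one (abs_le.2 ⟨by linarith, by linarith⟩),
      hat_of_abs_le_one (abs_le.2 ⟨by linarith, by linarith⟩), abs_of_nonpos (by linarith),
      abs_of_nonpos (by linarith), abs_of_nonpos (by linarith)]
    ring
  · subst h
    push_cast at ha hb
    rw [hat_of_abs_le_one (abs_le.2 ⟨by linarith, by linarith⟩),
      hat_of_abs_le_one (abs_le.2 ⟨by linarith, by linarith⟩),
      hat_of_abs_le_one (abs_le.2 ⟨by linarith, by linarith⟩), abs_of_nonneg (by linarith),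
      abs_of_nonneg (by linarith), abs_of_nonneg (by linarith)]
    ring
  · have h' : (1 : ℝ) ≤ k := by exact_mod_cast h
    rw [hat_of_one_le_abs (le_abs.2 (Or.inl (by linarith : 1 ≤ t))),
      hat_of_one_le_abs (le_abs.2 (Or.inl (by linarith : 1 ≤ a))),
      hat_of_one_le_abs (le_abs.2 (Or.inl (by linarith : 1 ≤ b)))]
    ring

theorem hat_sub_intCast (k c : ℤ) {y : ℝ} (h1 : (k : ℝ) ≤ y) (h2 : y ≤ k + 1) :
    hat (y - c) = hat (k - c) * (k + 1 - y) + hat (k + 1 - c) * (y - k) := by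
  have := hat_convex_comb (k - c) (a := k - c) (b := k + 1 - c) (t := y - c) (by push_cast; rfl)
    (by push_cast; linarith) (by linarith) (by linarith)
  linear_combination this

theorem ne_intCast_of_mem_Ioo {k : ℤ} {y : ℝ} (h1 : (k : ℝ) < y) (h2 : y < k + 1) (z : ℤ) :
    y ≠ z := by
  rintro rfl
  have h1 : k < z := by exact_mod_cast h1
  have h2 : z < k + 1 := by exact_mod_cast h2
  omega

theorem hasDerivAt_hat_of_ne_intCast {t : ℝ} (h : ∀ z : ℤ, t ≠ z) : HasDerivAt hat (dhat t) t :=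
  hasDerivAt_hat (by simpa using h 0) (by simpa using h 1) (by simpa using h (-1))

/-- Both sides are derivatives at `y` of the same function, by the affine formula `hat_sub_intCast`.
-/
theorem dhat_sub_intCast (k c : ℤ) {y : ℝ} (h1 : (k : ℝ) < y) (h2 : y < k + 1) :
    dhat (y - c) = hat (k + 1 - c) - hat (k - c) := by
  have hne : ∀ z : ℤ, y - c ≠ z := fun z hz =>
    ne_intCast_of_mem_Ioo h1 h2 (z + c) (by push_cast; linarith)
  have d1 : HasDerivAt (fun y : ℝ => hat (y - c)) (dhat (y - c)) y := by
    simpa using (hasDerivAt_hat_of_ne_intCast hne).comp_sub_const y (c : ℝ)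
  have d2 : HasDerivAt (fun y : ℝ => hat (k - c) * (k + 1 - y) + hat (k + 1 - c) * (y - k))
      (hat (k + 1 - c) - hat (k - c)) y := by
    have := (((hasDerivAt_id y).const_sub ((k : ℝ) + 1)).const_mul (hat (k - c))).add
      (((hasDerivAt_id y).sub_const (k : ℝ)).const_mul (hat (k + 1 - c)))
    refine this.congr_deriv (by ring)
  refine d1.unique (d2.congr_of_eventuallyEq ?_)
  filter_upwards [isOpen_Ioo.mem_nhds (⟨h1, h2⟩ : y ∈ Set.Ioo (k : ℝ) (k + 1))] with x hx
  exact hat_sub_intCast k c hx.1.le hx.2.le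

theorem hat_sub_eq_zero {y : ℝ} {z : ℤ} (h1 : z ≠ ⌊y⌋) (h2 : z ≠ ⌊y⌋ + 1) : hat (y - z) = 0 := by
  have f1 := Int.floor_le y
  have f2 := Int.lt_floor_add_one y
  apply hat_of_one_le_abs
  rcases lt_or_gt_of_ne h1 with h | h
  · have : (z : ℝ) + 1 ≤ ⌊y⌋ := by exact_mod_cast h
    exact le_abs.2 (Or.inl (by linarith))
  · have : (⌊y⌋ : ℝ) + 2 ≤ z := by
      have : ⌊y⌋ + 2 ≤ z := by omega
      exact_mod_cast this
    exact le_abs.2 (Or.inr (by linarith))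

theorem dhat_eq_zero_of_one_le_abs {t : ℝ} (h : 1 ≤ |t|) : dhat t = 0 := by
  unfold dhat
  rcases le_abs.1 h with h | h <;>
    rw [if_neg (by intro h'; linarith [h'.1, h'.2]), if_neg (by intro h'; linarith [h'.1, h'.2])]

theorem abs_dhat_le (t : ℝ) : |dhat t| ≤ 1 := by
  unfold dhat; split_ifs <;> simp

theorem dhat_sub_eq_zero {y : ℝ} {z : ℤ} (h1 : z ≠ ⌊y⌋) (h2 : z ≠ ⌊y⌋ + 1) : dhat (y - z) = 0 := by
  have h := hat_sub_eq_zero h1 h2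
  apply dhat_eq_zero_of_one_le_abs
  by_contra! hlt
  rw [hat_of_abs_le_one hlt.le] at h
  linarith

/-- Interpolation of integer nodal values by hat functions. -/
theorem sum_mul_hat (T : Finset ℤ) (f : ℤ → ℝ) (hf : ∀ z ∉ T, f z = 0) (y : ℝ) :
    ∑ z ∈ T, f z * hat (y - z) =
      f ⌊y⌋ * (⌊y⌋ + 1 - y) + f (⌊y⌋ + 1) * (y - ⌊y⌋) := by
  have f1 := Int.floor_le y
  have f2 := Int.lt_floor_add_one y
  have e1 : ∑ z ∈ T, f z * hat (y - z) = ∑ z ∈ T ∪ {⌊y⌋, ⌊y⌋ + 1}, f z * hat (y - z) :=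
    Finset.sum_subset Finset.subset_union_left fun z _ hz => by rw [hf z hz, zero_mul]
  have e2 : ∑ z ∈ ({⌊y⌋, ⌊y⌋ + 1} : Finset ℤ), f z * hat (y - z) =
      ∑ z ∈ T ∪ {⌊y⌋, ⌊y⌋ + 1}, f z * hat (y - z) :=
    Finset.sum_subset Finset.subset_union_right fun z _ hz => by
      simp only [Finset.mem_insert, Finset.mem_singleton, not_or] at hz
      rw [hat_sub_eq_zero hz.1 hz.2, mul_zero]
  rw [e1, ← e2, Finset.sum_pair (by simp)]
  push_cast
  rw [hat_of_abs_le_one (abs_le.2 ⟨by linarith, by linarith⟩),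
    hat_of_abs_le_one (abs_le.2 ⟨by linarith, by linarith⟩), abs_of_nonneg (by linarith),
    abs_of_nonpos (by linarith)]
  ring

/-- The hats are a partition of unity: once `T` contains both integers around `y`, interpolating the
constant 1 gives equality. -/
theorem sum_hat_le_one (T : Finset ℤ) (y : ℝ) : ∑ z ∈ T, hat (y - z) ≤ 1 := by
  have f1 := Int.floor_le y
  have f2 := Int.lt_floor_add_one y
  calc ∑ z ∈ T, hat (y - z) ≤ ∑ z ∈ T ∪ {⌊y⌋, ⌊y⌋ + 1}, hat (y - z) :=
        Finset.sum_le_sum_of_subset_of_nonneg Finset.subset_union_left fun _ _ _ => hat_nonneg _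
    _ = ∑ z ∈ T ∪ {⌊y⌋, ⌊y⌋ + 1},
          (if z ∈ T ∪ {⌊y⌋, ⌊y⌋ + 1} then (1 : ℝ) else 0) * hat (y - z) :=
        Finset.sum_congr rfl fun z hz => by rw [if_pos hz, one_mul]
    _ = 1 := by
        rw [sum_mul_hat (T ∪ {⌊y⌋, ⌊y⌋ + 1}) (fun z => if z ∈ T ∪ {⌊y⌋, ⌊y⌋ + 1} then 1 else 0)
          (fun z hz => if_neg hz)]
        simp only [Finset.union_insert, Finset.mem_insert, Finset.mem_union, Finset.mem_singleton,
          true_or, or_true, if_true]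
        ring

/-- Only the hats of the two integers around `y` can have a nonzero slope there, and slopes are at
most 1 in absolute value. -/
theorem sum_abs_dhat_le_two (T : Finset ℤ) (y : ℝ) : ∑ z ∈ T, |dhat (y - z)| ≤ 2 := by
  calc ∑ z ∈ T, |dhat (y - z)| ≤ ∑ z ∈ T ∪ {⌊y⌋, ⌊y⌋ + 1}, |dhat (y - z)| :=
        Finset.sum_le_sum_of_subset_of_nonneg Finset.subset_union_left fun _ _ _ => abs_nonneg _
    _ = ∑ z ∈ ({⌊y⌋, ⌊y⌋ + 1} : Finset ℤ), |dhat (y - z)| := by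
        symm
        refine Finset.sum_subset Finset.subset_union_right fun z _ hz => ?_
        simp only [Finset.mem_insert, Finset.mem_singleton, not_or] at hz
        rw [dhat_sub_eq_zero hz.1 hz.2, abs_zero]
    _ ≤ 2 := by
        rw [Finset.sum_pair (by simp)]
        linarith [abs_dhat_le (y - ⌊y⌋), abs_dhat_le (y - (⌊y⌋ + 1 : ℤ))]

theorem sum_fin_eq_sum_Icc {n : ℕ} (f : ℤ → ℝ) :
    ∑ w : Fin n, f ((w : ℤ) + 1) = ∑ z ∈ Finset.Icc (1 : ℤ) n, f z := by
  refine Finset.sum_bij (fun w _ => (w : ℤ) + 1) ?_ ?_ ?_ ?_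
  · intro w _
    have := w.2
    simp only [Finset.mem_Icc]; omega
  · intro a _ b _ h
    apply Fin.ext; omega
  · intro z hz
    simp only [Finset.mem_Icc] at hz
    exact ⟨⟨(z - 1).toNat, by omega⟩, Finset.mem_univ _, by simp; omega⟩
  · intros; rfl

theorem sum_fin_hat_le_one (n : ℕ) (y : ℝ) : ∑ j : Fin n, hat (y - ((j : ℕ) + 1)) ≤ 1 := by
  have := sum_fin_eq_sum_Icc (n := n) (fun z => hat (y - z))
  push_cast at this
  rw [this]; exact sum_hat_le_one _ _

theorem sum_fin_abs_dhat_le_two (n : ℕ) (y : ℝ) :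
    ∑ j : Fin n, |dhat (y - ((j : ℕ) + 1))| ≤ 2 := by
  have := sum_fin_eq_sum_Icc (n := n) (fun z => |dhat (y - z)|)
  push_cast at this
  rw [this]; exact sum_abs_dhat_le_two _ _

/-- A hat function of a coarse dyadic grid is the interpolation of its values at the interior
vertices of a finer one. -/
theorem hat_refinement {l L : ℕ} (hl : l ≤ L) (j : Fin (2 ^ l - 1)) (y : ℝ) :
    ∑ w : Fin (2 ^ L - 1), hat (2 ^ l * (((w : ℕ) + 1) / 2 ^ L) - ((j : ℕ) + 1)) *
      hat (y - ((w : ℕ) + 1)) = hat (2 ^ l * (y / 2 ^ L) - ((j : ℕ) + 1)) := by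
  obtain ⟨r, rfl⟩ := Nat.exists_eq_add_of_le hl
  have h2l : (0 : ℝ) < 2 ^ l := by positivity
  have h2r : (0 : ℝ) < 2 ^ r := by positivity
  have hpow : ∀ t : ℝ, 2 ^ l * (t / 2 ^ (l + r)) = t / 2 ^ r := fun t => by
    rw [pow_add]; field_simp
  simp only [hpow]
  have hj := j.2
  have hjR : ((j : ℕ) : ℝ) + 2 ≤ 2 ^ l := by
    have : (j : ℕ) + 2 ≤ 2 ^ l := by omega
    exact_mod_cast this
  have hs := sum_fin_eq_sum_Icc (n := 2 ^ (l + r) - 1)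
    (fun z : ℤ => hat ((z : ℝ) / 2 ^ r - ((j : ℕ) + 1)) * hat (y - z))
  push_cast at hs
  rw [hs, sum_mul_hat _ (fun z : ℤ => hat ((z : ℝ) / 2 ^ r - ((j : ℕ) + 1)))]
  · set k := ⌊y⌋
    have f1 : (k : ℝ) ≤ y := Int.floor_le y
    have f2 : y < k + 1 := Int.lt_floor_add_one y
    -- `e` is the coarse cell that contains the fine cell `[k, k + 1]`; the coarse hat is affine on
    -- it, hence equal to its fine interpolant.
    set e : ℤ := k / 2 ^ r
    have he1 : e * 2 ^ r ≤ k := Int.ediv_mul_le k (by positivity)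
    have he2 : k + 1 ≤ (e + 1) * 2 ^ r := Int.lt_ediv_add_one_mul_self k (by positivity)
    have he1' : (e : ℝ) ≤ k / 2 ^ r := by
      rw [le_div_iff₀ h2r]; exact_mod_cast he1
    have he2' : ((k : ℝ) + 1) / 2 ^ r ≤ e + 1 := by
      rw [div_le_iff₀ h2r]; exact_mod_cast he2
    have := hat_convex_comb (e - (j + 1)) (a := k / 2 ^ r - ((j : ℕ) + 1))
      (b := (k + 1) / 2 ^ r - ((j : ℕ) + 1)) (t := y / 2 ^ r - ((j : ℕ) + 1))
      (by push_cast; linarith) (by push_cast; linarith)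
      (by have : (k : ℝ) / 2 ^ r ≤ y / 2 ^ r := by gcongr
          linarith)
      (by have : y / 2 ^ r ≤ ((k : ℝ) + 1) / 2 ^ r := by gcongr
          linarith)
    push_cast
    have h1 : ((k + 1) / 2 ^ r - ((j : ℕ) + 1) - (k / 2 ^ r - ((j : ℕ) + 1)) : ℝ) = 1 / 2 ^ r := by
      ring
    have h2 : ((k + 1) / 2 ^ r - ((j : ℕ) + 1) - (y / 2 ^ r - ((j : ℕ) + 1)) : ℝ) =
      (k + 1 - y) / 2 ^ r := by ring
    have h3 : (y / 2 ^ r - ((j : ℕ) + 1) - (k / 2 ^ r - ((j : ℕ) + 1)) : ℝ) =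
      (y - k) / 2 ^ r := by ring
    rw [h1, h2, h3] at this
    field_simp at this
    field_simp
    linear_combination -this
  -- The vertices left out of the sum do not matter: the coarse vertex is interior, so its hat
  -- vanishes at and beyond the ends of the interval.
  · intro z hz
    simp only [Finset.mem_Icc, not_and_or, not_le] at hz
    apply hat_of_one_le_abs
    rcases hz with hz | hz
    · have : (z : ℝ) ≤ 0 := by
        have : z ≤ 0 := by omega
        exact_mod_cast this
      have h : (z : ℝ) / 2 ^ r ≤ 0 := div_nonpos_of_nonpos_of_nonneg this h2r.le
      exact le_abs.2 (Or.inr (by linarith [(Nat.cast_nonneg (j : ℕ) : (0 : ℝ) ≤ (j : ℕ))]))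
    · have h1 : 1 ≤ 2 ^ (l + r) := Nat.one_le_two_pow
      have : (2 : ℝ) ^ (l + r) ≤ z := by
        have : (2 : ℤ) ^ (l + r) ≤ z := by
          rw [Nat.cast_sub h1] at hz; push_cast at hz; omega
        exact_mod_cast this
      have h : (2 : ℝ) ^ l ≤ z / 2 ^ r := by
        rw [le_div_iff₀ h2r, ← pow_add]; exact this
      exact le_abs.2 (Or.inl (by linarith))

/-- The derivative of `hat_refinement`. -/
theorem dhat_refinement {l L : ℕ} (hl : l ≤ L) (j : Fin (2 ^ l - 1)) {y : ℝ}
    (hy : ∀ z : ℤ, y ≠ z) :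
    ∑ w : Fin (2 ^ L - 1), hat (2 ^ l * (((w : ℕ) + 1) / 2 ^ L) - ((j : ℕ) + 1)) *
      dhat (y - ((w : ℕ) + 1)) =
        2 ^ l / 2 ^ L * dhat (2 ^ l * (y / 2 ^ L) - ((j : ℕ) + 1)) := by
  have d1 : HasDerivAt (fun y : ℝ => ∑ w : Fin (2 ^ L - 1),
      hat (2 ^ l * (((w : ℕ) + 1) / 2 ^ L) - ((j : ℕ) + 1)) * hat (y - ((w : ℕ) + 1)))
      (∑ w : Fin (2 ^ L - 1), hat (2 ^ l * (((w : ℕ) + 1) / 2 ^ L) - ((j : ℕ) + 1)) *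
        dhat (y - ((w : ℕ) + 1))) y := by
    refine HasDerivAt.fun_sum fun w _ => HasDerivAt.const_mul _ ?_
    refine HasDerivAt.comp_sub_const y _ (hasDerivAt_hat_of_ne_intCast fun z hz => ?_)
    exact hy (z + (w : ℕ) + 1) (by push_cast; linarith)
  have d2 : HasDerivAt (fun y : ℝ => hat (2 ^ l * (y / 2 ^ L) - ((j : ℕ) + 1)))
      (dhat (2 ^ l * (y / 2 ^ L) - ((j : ℕ) + 1)) * (2 ^ l * (1 / 2 ^ L))) y := by
    refine HasDerivAt.comp (h₂ := hat) y (hasDerivAt_hat_of_ne_intCast fun z hz => ?_)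
      ((((hasDerivAt_id y).div_const _).const_mul _).sub_const _)
    obtain ⟨r, rfl⟩ := Nat.exists_eq_add_of_le hl
    -- Kinks of the coarse hat are vertices of the fine grid, which `y` avoids.
    refine hy ((z + (j : ℕ) + 1) * 2 ^ r) ?_
    push_cast
    have : 2 ^ l * (y / 2 ^ (l + r)) = y / 2 ^ r := by
      rw [pow_add]; field_simp
    rw [this] at hz
    rw [← hz]; field_simp; ring
  have : (fun y : ℝ => ∑ w : Fin (2 ^ L - 1),
      hat (2 ^ l * (((w : ℕ) + 1) / 2 ^ L) - ((j : ℕ) + 1)) * hat (y - ((w : ℕ) + 1))) =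
      fun y : ℝ => hat (2 ^ l * (y / 2 ^ L) - ((j : ℕ) + 1)) :=
    funext fun y => hat_refinement hl j y
  rw [this] at d1
  rw [d1.unique d2]; ring

/-! ### Integrals of the hat function and of its slope -/

theorem integrable_hat : Integrable hat := by
  refine continuous_hat.integrable_of_hasCompactSupport ?_
  refine HasCompactSupport.intro (isCompact_Icc (a := (-1 : ℝ)) (b := 1)) fun x hx => ?_
  refine hat_of_one_le_abs ?_
  by_contra! h
  exact hx ⟨(abs_lt.1 h).1.le, (abs_lt.1 h).2.le⟩

theorem integral_hat : ∫ t, hat t = 1 := by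
  have h : ∫ t in Set.Ioc (-1 : ℝ) 1, hat t = ∫ t, hat t :=
    setIntegral_eq_integral_of_forall_compl_eq_zero fun x hx => by
      refine hat_of_one_le_abs ?_
      by_contra! h
      exact hx ⟨(abs_lt.1 h).1, (abs_lt.1 h).2.le⟩
  rw [← h, ← intervalIntegral.integral_of_le (by norm_num)]
  have hi : ∀ a b : ℝ, IntervalIntegrable hat volume a b := fun a b =>
    continuous_hat.intervalIntegrable a b
  rw [← intervalIntegral.integral_add_adjacent_intervals (hi (-1) 0) (hi 0 1)]
  have e1 : ∫ t in (-1 : ℝ)..0, hat t = ∫ t in (-1 : ℝ)..0, (1 + t) :=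
    intervalIntegral.integral_congr fun t ht => by
      rw [Set.uIcc_of_le (by norm_num)] at ht
      rw [hat_of_abs_le_one (abs_le.2 ⟨ht.1, by linarith [ht.2]⟩), abs_of_nonpos ht.2]; ring
  have e2 : ∫ t in (0 : ℝ)..1, hat t = ∫ t in (0 : ℝ)..1, (1 - t) :=
    intervalIntegral.integral_congr fun t ht => by
      rw [Set.uIcc_of_le (by norm_num)] at ht
      rw [hat_of_abs_le_one (abs_le.2 ⟨by linarith [ht.1], ht.2⟩), abs_of_nonneg ht.1]
  rw [e1, e2, intervalIntegral.integral_add (by simp) (by simp),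
    intervalIntegral.integral_sub (by simp) (by simp)]
  simp
  norm_num

theorem abs_dhat_le_indicator (t : ℝ) : |dhat t| ≤ (Set.Ioo (-1 : ℝ) 1).indicator 1 t := by
  by_cases h : t ∈ Set.Ioo (-1 : ℝ) 1
  · rw [Set.indicator_of_mem h]; exact abs_dhat_le t
  · rw [Set.indicator_of_notMem h, dhat_eq_zero_of_one_le_abs, abs_zero]
    by_contra! h'
    exact h (abs_lt.1 h')

theorem integrable_abs_dhat : Integrable fun t => |dhat t| := by
  have : Integrable ((Set.Ioo (-1 : ℝ) 1).indicator (1 : ℝ → ℝ)) :=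
    (integrable_indicator_iff measurableSet_Ioo).2
      (integrableOn_const (by simp) : IntegrableOn (fun _ => (1 : ℝ)) _ _)
  refine this.mono' (measurable_dhat.abs).aestronglyMeasurable (ae_of_all _ fun t => ?_)
  simpa using abs_dhat_le_indicator t

theorem integral_abs_dhat_le : ∫ t, |dhat t| ≤ 2 := by
  have hi : Integrable ((Set.Ioo (-1 : ℝ) 1).indicator (1 : ℝ → ℝ)) :=
    (integrable_indicator_iff measurableSet_Ioo).2
      (integrableOn_const (by simp) : IntegrableOn (fun _ => (1 : ℝ)) _ _)
  calc ∫ t, |dhat t| ≤ ∫ t, (Set.Ioo (-1 : ℝ) 1).indicator (1 : ℝ → ℝ) t :=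
        integral_mono integrable_abs_dhat hi abs_dhat_le_indicator
    _ = 2 := by
        rw [integral_indicator_one measurableSet_Ioo]
        simp [Measure.real]
        norm_num

/-! ### Partial derivatives of nodal functions -/

/-- The factor in direction `t` of the partial derivative in direction `s` of a nodal function. -/
def profile {d : ℕ} (s t : Fin d) : ℝ → ℝ := if t = s then dhat else hat

/-- The partial derivative in direction `s`, away from the kinks, of the `d`-linear nodal function
of the grid of mesh size `2 ^ (-l)` centred at `2 ^ (-l) b`. -/
def pder {d : ℕ} (l : ℕ) (b : Fin d → ℝ) (s : Fin d) (x : Fin d → ℝ) : ℝ :=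
  2 ^ l * ∏ t, profile s t (2 ^ l * x t - b t)

theorem grad_nodalFun {d : ℕ} {l : ℕ} {c : Fin d → ℕ} {s : Fin d} {x : Fin d → ℝ}
    (hx : ∀ z : ℤ, 2 ^ l * x s ≠ z) :
    grad (nodalFun l c) x s = pder l (fun t => (c t : ℝ)) s x := by
  have h1 : HasDerivAt (fun r : ℝ => hat (2 ^ l * (x s + r) - c s))
      (dhat (2 ^ l * x s - c s) * 2 ^ l) 0 := by
    have h := hasDerivAt_hat_of_ne_intCast (t := 2 ^ l * (x s + 0) - c s) fun z hz =>
      hx (z + c s) (by push_cast; linarith)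
    have h2 : HasDerivAt (fun r : ℝ => 2 ^ l * (x s + r) - (c s : ℝ)) (2 ^ l) 0 := by
      simpa using ((((hasDerivAt_id (0 : ℝ)).const_add (x s)).const_mul ((2 : ℝ) ^ l)).sub_const
        (c s : ℝ))
    have h3 := HasDerivAt.comp (h₂ := hat) (0 : ℝ) h h2
    rw [add_zero] at h3
    exact h3
  have h2 := h1.mul_const (∏ t ∈ Finset.univ.erase s, hat (2 ^ l * x t - c t))
  have e : (fun r : ℝ => nodalFun l c (x + r • Pi.single s (1 : ℝ))) = fun r : ℝ =>
      hat (2 ^ l * (x s + r) - c s) * ∏ t ∈ Finset.univ.erase s, hat (2 ^ l * x t - c t) := by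
    funext r
    rw [nodalFun, ← Finset.mul_prod_erase _ _ (Finset.mem_univ s)]
    congr 1
    · simp
    · refine Finset.prod_congr rfl fun t ht => ?_
      simp [Pi.single_eq_of_ne (Finset.ne_of_mem_erase ht)]
  rw [grad, lineDeriv, e, h2.deriv, pder, ← Finset.mul_prod_erase _ _ (Finset.mem_univ s)]
  have e2 : ∏ t ∈ Finset.univ.erase s, profile s t (2 ^ l * x t - c t) =
      ∏ t ∈ Finset.univ.erase s, hat (2 ^ l * x t - c t) :=
    Finset.prod_congr rfl fun t ht => by rw [profile, if_neg (Finset.ne_of_mem_erase ht)]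
  rw [e2, profile, if_pos rfl]
  ring

/-! ### The space `ℚ₁` -/

theorem prod_affine_mem_QOne {d : ℕ} (a b : Fin d → ℝ) :
    (fun x : Fin d → ℝ => ∏ t, (a t + b t * x t)) ∈ QOne d := by
  have : (fun x : Fin d → ℝ => ∏ t, (a t + b t * x t)) =
      ∑ S ∈ (Finset.univ : Finset (Fin d)).powerset,
        ((∏ t ∈ S, b t) * ∏ t ∈ Finset.univ \ S, a t) •
          fun x : Fin d → ℝ => ∏ t ∈ S, x t := by
    funext x
    simp_rw [add_comm (a _)]
    rw [Finset.prod_add, Finset.sum_apply]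
    refine Finset.sum_congr rfl fun S _ => ?_
    rw [Finset.prod_mul_distrib, Pi.smul_apply, smul_eq_mul]
    ring
  rw [this]
  exact Submodule.sum_mem _ fun S _ =>
    Submodule.smul_mem _ _ (Submodule.subset_span (Set.mem_range_self S))

theorem continuous_of_mem_QOne {d : ℕ} {q : (Fin d → ℝ) → ℝ} (hq : q ∈ QOne d) :
    Continuous q := by
  refine Submodule.span_induction (p := fun q _ => Continuous q) ?_ ?_ ?_ ?_ hq
  · rintro _ ⟨S, rfl⟩
    exact continuous_finsetProd S fun t _ => continuous_apply t
  · exact continuous_const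
  · exact fun _ _ _ _ hx hy => hx.add hy
  · exact fun a _ _ hx => hx.const_smul a

namespace DDGeometry

variable {d : ℕ} (G : DDGeometry d)

/-! ### Mesh elements -/

theorem measurableSet_cellSet (K : G.Cell) : MeasurableSet (G.cellSet K) :=
  MeasurableSet.univ_pi fun _ => measurableSet_Ioo

theorem mem_cellSet_scaled {K : G.Cell} {x : Fin d → ℝ} (hx : x ∈ G.cellSet K) (t : Fin d) :
    (((K t : ℕ) : ℤ) : ℝ) < 2 ^ G.L * x t ∧ 2 ^ G.L * x t < (((K t : ℕ) : ℤ) : ℝ) + 1 := by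
  obtain ⟨h1, h2⟩ := hx t (Set.mem_univ t)
  have hp : (0 : ℝ) < 2 ^ G.L := by positivity
  rw [div_lt_iff₀ hp] at h1
  rw [lt_div_iff₀ hp] at h2
  push_cast
  constructor <;> linarith

theorem ne_intCast_of_mem_cellSet {K : G.Cell} {x : Fin d → ℝ} (hx : x ∈ G.cellSet K)
    (t : Fin d) (z : ℤ) : 2 ^ G.L * x t ≠ z :=
  ne_intCast_of_mem_Ioo (G.mem_cellSet_scaled hx t).1 (G.mem_cellSet_scaled hx t).2 z

theorem pairwise_disjoint_cellSet : Pairwise (Function.onFun Disjoint G.cellSet) := by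
  intro K K' hne
  refine Set.disjoint_left.2 fun x hx hx' => hne ?_
  funext t
  have h := G.mem_cellSet_scaled hx t
  have h' := G.mem_cellSet_scaled hx' t
  have h1 : ((K t : ℕ) : ℤ) < ((K' t : ℕ) : ℤ) + 1 := by exact_mod_cast h.1.trans h'.2
  have h2 : ((K' t : ℕ) : ℤ) < ((K t : ℕ) : ℤ) + 1 := by exact_mod_cast h'.1.trans h.2
  apply Fin.ext; omega

theorem Ω_eq : G.Ω = Set.pi Set.univ fun s => Set.Icc 0 ((G.cells s : ℝ) / 2 ^ G.L) := by
  simp only [Ω, G.cells_div]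

theorem cellSet_subset_Ω (K : G.Cell) : G.cellSet K ⊆ G.Ω := by
  rw [Ω_eq]
  intro x hx t _
  have h := hx t (Set.mem_univ t)
  have hK : ((K t : ℕ) : ℝ) + 1 ≤ G.cells t := by exact_mod_cast (K t).2
  refine ⟨le_trans (by positivity) h.1.le, h.2.le.trans ?_⟩
  gcongr

theorem isCompact_Ω : IsCompact G.Ω := isCompact_univ_pi fun _ => isCompact_Icc

theorem integrableOn_cellSet {f : (Fin d → ℝ) → ℝ} (hf : Continuous f) (K : G.Cell) :
    IntegrableOn f (G.cellSet K) :=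
  (hf.continuousOn.integrableOn_compact G.isCompact_Ω).mono_set (G.cellSet_subset_Ω K)

/-- The mesh elements cover the domain up to a null set. -/
theorem iUnion_cellSet_ae_eq : (⋃ K, G.cellSet K) =ᵐ[volume] G.Ω := by
  refine Filter.EventuallyLE.antisymm
    (ae_of_all _ (Set.iUnion_subset G.cellSet_subset_Ω)) ?_
  have hnull : ∀ᵐ x : Fin d → ℝ, ∀ (s : Fin d) (z : ℕ), x s ≠ (z : ℝ) / 2 ^ G.L := by
    rw [ae_all_iff]; intro s
    rw [ae_all_iff]; intro z
    exact compl_mem_ae_iff.2 (Measure.pi_hyperplane (fun _ => volume) s _)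
  filter_upwards [hnull] with x hx hxΩ
  rw [Ω_eq] at hxΩ
  have hp : (0 : ℝ) < 2 ^ G.L := by positivity
  have hlt : ∀ s, ⌊2 ^ G.L * x s⌋₊ < G.cells s := by
    intro s
    obtain ⟨h1, h2⟩ := hxΩ s (Set.mem_univ s)
    have h3 : x s < (G.cells s : ℝ) / 2 ^ G.L := lt_of_le_of_ne h2 (hx s _)
    rw [lt_div_iff₀ hp] at h3
    rw [Nat.floor_lt (by positivity)]
    linarith
  refine Set.mem_iUnion.2 ⟨fun s => ⟨⌊2 ^ G.L * x s⌋₊, hlt s⟩, fun s _ => ?_⟩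
  obtain ⟨h1, h2⟩ := hxΩ s (Set.mem_univ s)
  have f1 := Nat.floor_le (mul_nonneg hp.le h1)
  have f2 := Nat.lt_floor_add_one (2 ^ G.L * x s)
  refine ⟨lt_of_le_of_ne ?_ (Ne.symm (hx s _)), ?_⟩
  · change (⌊2 ^ G.L * x s⌋₊ : ℝ) / 2 ^ G.L ≤ x s
    rw [div_le_iff₀ hp]; linarith
  · change x s < ((⌊2 ^ G.L * x s⌋₊ : ℝ) + 1) / 2 ^ G.L
    rw [lt_div_iff₀ hp]; linarith

theorem setIntegral_Ω {f : (Fin d → ℝ) → ℝ} (hf : ∀ K, IntegrableOn f (G.cellSet K)) :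
    ∫ x in G.Ω, f x = ∑ K, ∫ x in G.cellSet K, f x := by
  rw [← setIntegral_congr_set G.iUnion_cellSet_ae_eq]
  exact integral_iUnion_fintype G.measurableSet_cellSet G.pairwise_disjoint_cellSet hf

theorem sum_setIntegral_cellSet_le {f : (Fin d → ℝ) → ℝ} (h0 : 0 ≤ f) (hf : Integrable f) :
    ∑ K, ∫ x in G.cellSet K, f x ≤ ∫ x, f x := by
  rw [← integral_iUnion_fintype G.measurableSet_cellSet G.pairwise_disjoint_cellSet
    fun K => hf.integrableOn]
  exact setIntegral_le_integral hf (ae_of_all _ h0)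

/-! ### Elementwise gradients -/

/-- On one cell every hat factor is affine and the differentiated factor is constant, so the partial
derivative is a product of affine functions of single variables. This makes the representation of
gradients in the discontinuous space exact. -/
theorem exists_QOne_pder (K : G.Cell) (c : Fin d → ℤ) (s : Fin d) :
    ∃ q ∈ QOne d, ∀ x ∈ G.cellSet K, pder G.L (fun t => (c t : ℝ)) s x = q x := by
  refine ⟨_, Submodule.smul_mem _ ((2 : ℝ) ^ G.L) (prod_affine_mem_QOne
    (fun t => if t = s then hat ((K t : ℕ) + 1 - c t) - hat ((K t : ℕ) - c t) else
      hat ((K t : ℕ) - c t) * ((K t : ℕ) + 1) - hat ((K t : ℕ) + 1 - c t) * (K t : ℕ))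
    (fun t => if t = s then 0 else
      (hat ((K t : ℕ) + 1 - c t) - hat ((K t : ℕ) - c t)) * 2 ^ G.L)), fun x hx => ?_⟩
  rw [pder, Pi.smul_apply, smul_eq_mul]
  congr 1
  refine Finset.prod_congr rfl fun t _ => ?_
  obtain ⟨h1, h2⟩ := G.mem_cellSet_scaled hx t
  by_cases hts : t = s
  · rw [profile, if_pos hts, if_pos hts, if_pos hts, dhat_sub_intCast _ _ h1 h2]
    push_cast; ring
  · rw [profile, if_neg hts, if_neg hts, if_neg hts, hat_sub_intCast _ _ h1.le h2.le]
    push_cast; ring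

/-- The partial derivative in direction `s` of the finite element function with the nodal
values `x`. -/
def gradSum (x : G.Vertex → ℝ) (s : Fin d) (y : Fin d → ℝ) : ℝ :=
  ∑ v : G.Vertex, x v * pder G.L (fun t => ((v t : ℕ) : ℝ) + 1) s y

theorem exists_QOne_gradSum (K : G.Cell) (x : G.Vertex → ℝ) (s : Fin d) :
    ∃ q ∈ QOne d, ∀ y ∈ G.cellSet K, G.gradSum x s y = q y := by
  choose q hq hqe using fun v : G.Vertex =>
    G.exists_QOne_pder K (fun t => ((v t : ℕ) : ℤ) + 1) s
  refine ⟨∑ v, x v • q v, Submodule.sum_mem _ fun v _ => Submodule.smul_mem _ _ (hq v),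
    fun y hy => ?_⟩
  rw [gradSum, Finset.sum_apply]
  refine Finset.sum_congr rfl fun v _ => ?_
  rw [Pi.smul_apply, smul_eq_mul, ← hqe v y hy]
  push_cast
  rfl

variable {G}

theorem grad_φ {K : G.Cell} {y : Fin d → ℝ} (hy : y ∈ G.cellSet K) (v : G.Vertex) (s : Fin d) :
    grad (G.φ v) y s = pder G.L (fun t => ((v t : ℕ) : ℝ) + 1) s y := by
  rw [φ, grad_nodalFun (G.ne_intCast_of_mem_cellSet hy s)]
  push_cast
  rfl

theorem gradSum_single {K : G.Cell} {y : Fin d → ℝ} (hy : y ∈ G.cellSet K) (v : G.Vertex)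
    (s : Fin d) : G.gradSum (Pi.single v 1) s y = grad (G.φ v) y s := by
  rw [grad_φ hy, gradSum, Finset.sum_eq_single v]
  · simp
  · intro w _ hw; simp [Pi.single_eq_of_ne hw]
  · simp

/-! ### Expansion in the discontinuous orthonormal basis -/

variable {ψ : G.Cell → Fin (2 ^ d) → (Fin d → ℝ) → ℝ}

namespace IsDGBasis

theorem mem_QOne (h : G.IsDGBasis ψ) (K : G.Cell) (k : Fin (2 ^ d)) : ψ K k ∈ QOne d := by
  rw [← h.span_eq K]; exact Submodule.subset_span (Set.mem_range_self k)

theorem integrableOn_mul (K : G.Cell) {p q : (Fin d → ℝ) → ℝ} (hp : p ∈ QOne d)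
    (hq : q ∈ QOne d) : IntegrableOn (fun x => p x * q x) (G.cellSet K) :=
  G.integrableOn_cellSet ((continuous_of_mem_QOne hp).mul (continuous_of_mem_QOne hq)) K

theorem expansion (h : G.IsDGBasis ψ) (K : G.Cell) {p : (Fin d → ℝ) → ℝ} (hp : p ∈ QOne d)
    (x : Fin d → ℝ) : p x = ∑ k, (∫ y in G.cellSet K, p y * ψ K k y) * ψ K k x := by
  have hp' := hp
  rw [← h.span_eq K, Submodule.mem_span_range_iff_exists_fun] at hp'
  obtain ⟨a, rfl⟩ := hp'
  have ha : ∀ k, ∫ y in G.cellSet K, (∑ i, a i • ψ K i) y * ψ K k y = a k := by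
    intro k
    have e : ∀ y, (∑ i, a i • ψ K i) y * ψ K k y = ∑ i, a i * (ψ K i y * ψ K k y) := by
      intro y
      rw [Finset.sum_apply, Finset.sum_mul]
      exact Finset.sum_congr rfl fun i _ => by rw [Pi.smul_apply, smul_eq_mul, mul_assoc]
    simp_rw [e]
    rw [integral_finsetSum _ fun i _ =>
      (integrableOn_mul K (h.mem_QOne K i) (h.mem_QOne K k)).const_mul (a i)]
    simp_rw [integral_const_mul, h.orthonormal]
    simp
  simp_rw [ha]
  simp [Finset.sum_apply]

theorem parseval (h : G.IsDGBasis ψ) (K : G.Cell) {p q : (Fin d → ℝ) → ℝ} (hp : p ∈ QOne d)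
    (hq : q ∈ QOne d) : ∑ k, (∫ y in G.cellSet K, p y * ψ K k y) *
      (∫ y in G.cellSet K, q y * ψ K k y) = ∫ y in G.cellSet K, p y * q y := by
  have e : ∀ y, p y * q y =
      ∑ k, (∫ y in G.cellSet K, p y * ψ K k y) * (q y * ψ K k y) := by
    intro y
    rw [h.expansion K hp y, Finset.sum_mul]
    refine Finset.sum_congr rfl fun k _ => ?_
    ring
  simp_rw [e]
  rw [integral_finsetSum _ fun k _ => (integrableOn_mul K hq (h.mem_QOne K k)).const_mul _]
  simp_rw [integral_const_mul]

end IsDGBasis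

theorem gradMatrix_mulVec (h : G.IsDGBasis ψ) (x : G.Vertex → ℝ) (s : Fin d) (K : G.Cell)
    (k : Fin (2 ^ d)) : (G.gradMatrix ψ *ᵥ x) ((s, K), k) =
      ∫ y in G.cellSet K, G.gradSum x s y * ψ K k y := by
  have e : ∀ y, G.gradSum x s y * ψ K k y = ∑ v : G.Vertex, x v *
      (pder G.L (fun t => ((v t : ℕ) : ℝ) + 1) s y * ψ K k y) := by
    intro y
    rw [gradSum, Finset.sum_mul]
    exact Finset.sum_congr rfl fun v _ => by ring
  have hc : ∀ v : G.Vertex, gradMatrix G ψ ((s, K), k) v = ∫ y in G.cellSet K,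
      pder G.L (fun t => ((v t : ℕ) : ℝ) + 1) s y * ψ K k y := fun v =>
    setIntegral_congr_fun (G.measurableSet_cellSet K) fun y hy => by
      simp only [grad_φ hy]
  simp_rw [e]
  rw [integral_finsetSum]
  · simp_rw [integral_const_mul, Matrix.mulVec, dotProduct, hc]
    exact Finset.sum_congr rfl fun v _ => mul_comm _ _
  · intro v _
    obtain ⟨q, hq, hqe⟩ := G.exists_QOne_pder K (fun t => ((v t : ℕ) : ℤ) + 1) s
    refine Integrable.const_mul ?_ _
    refine (IsDGBasis.integrableOn_mul K hq (h.mem_QOne K k)).congr_fun (fun y hy => ?_)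
      (G.measurableSet_cellSet K)
    beta_reduce
    rw [← hqe y hy]
    push_cast
    rfl

/-- Parseval on one cell: the rows of `gradMatrix` hold the coefficients of partial derivatives that
belong to `ℚ₁` there. -/
theorem sum_gradMatrix_mulVec (h : G.IsDGBasis ψ) (x x' : G.Vertex → ℝ) (s t : Fin d)
    (K : G.Cell) : ∑ k, (G.gradMatrix ψ *ᵥ x) ((s, K), k) * (G.gradMatrix ψ *ᵥ x') ((t, K), k) =
      ∫ y in G.cellSet K, G.gradSum x s y * G.gradSum x' t y := by
  obtain ⟨p, hp, hpe⟩ := G.exists_QOne_gradSum K x s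
  obtain ⟨q, hq, hqe⟩ := G.exists_QOne_gradSum K x' t
  have h1 : ∀ k, (G.gradMatrix ψ *ᵥ x) ((s, K), k) = ∫ y in G.cellSet K, p y * ψ K k y :=
    fun k => by
      rw [gradMatrix_mulVec h]
      exact setIntegral_congr_fun (G.measurableSet_cellSet K) fun y hy => by simp only [hpe y hy]
  have h2 : ∀ k, (G.gradMatrix ψ *ᵥ x') ((t, K), k) = ∫ y in G.cellSet K, q y * ψ K k y :=
    fun k => by
      rw [gradMatrix_mulVec h]
      exact setIntegral_congr_fun (G.measurableSet_cellSet K) fun y hy => by simp only [hqe y hy]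
  simp_rw [h1, h2]
  rw [h.parseval K hp hq]
  exact setIntegral_congr_fun (G.measurableSet_cellSet K) fun y hy => by
    simp only [hpe y hy, hqe y hy]

/-- The stiffness matrix is factored by the elementwise gradient. -/
theorem stiffness_eq (h : G.IsDGBasis ψ) {ρ : (Fin d → ℝ) → Matrix (Fin d) (Fin d) ℝ}
    {ρK : G.Cell → Matrix (Fin d) (Fin d) ℝ} (hρ : ∀ K, ∀ x ∈ G.cellSet K, ρ x = ρK K)
    (hsymm : ∀ K, (ρK K)ᵀ = ρK K) :
    G.stiffness ρ = (G.gradMatrix ψ)ᵀ *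
      (G.coeffMatrix ρK ⊗ₖ (1 : Matrix (Fin (2 ^ d)) (Fin (2 ^ d)) ℝ)) * G.gradMatrix ψ := by
  ext v w
  have hint : ∀ K (s t : Fin d), IntegrableOn (fun y => G.gradSum (Pi.single v 1) s y *
      G.gradSum (Pi.single w 1) t y) (G.cellSet K) := by
    intro K s t
    obtain ⟨p, hp, hpe⟩ := G.exists_QOne_gradSum K (Pi.single v 1) s
    obtain ⟨q, hq, hqe⟩ := G.exists_QOne_gradSum K (Pi.single w 1) t
    refine (IsDGBasis.integrableOn_mul K hp hq).congr_fun (fun y hy => ?_)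
      (G.measurableSet_cellSet K)
    simp only [hpe y hy, hqe y hy]
  have hcell : ∀ K, Set.EqOn (fun x => (ρ x *ᵥ grad (G.φ v) x) ⬝ᵥ grad (G.φ w) x)
      (fun y => ∑ t, ∑ s, ρK K t s * (G.gradSum (Pi.single v 1) s y *
        G.gradSum (Pi.single w 1) t y)) (G.cellSet K) := by
    intro K y hy
    simp only [hρ K y hy, dotProduct, Matrix.mulVec, gradSum_single hy, Finset.sum_mul]
    exact Finset.sum_congr rfl fun t _ => Finset.sum_congr rfl fun s _ => by ring
  have hint2 : ∀ K, IntegrableOn (fun y => ∑ t, ∑ s, ρK K t s *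
      (G.gradSum (Pi.single v 1) s y * G.gradSum (Pi.single w 1) t y)) (G.cellSet K) := fun K =>
    integrable_finsetSum _ fun t _ => integrable_finsetSum _ fun s _ => (hint K s t).const_mul _
  have lhs : G.stiffness ρ v w = ∑ K, ∑ t, ∑ s, ρK K t s *
      ∑ k, G.gradMatrix ψ ((s, K), k) v * G.gradMatrix ψ ((t, K), k) w := by
    rw [stiffness, Matrix.of_apply, G.setIntegral_Ω fun K =>
      (hint2 K).congr_fun (hcell K).symm (G.measurableSet_cellSet K)]
    refine Finset.sum_congr rfl fun K _ => ?_
    rw [setIntegral_congr_fun (G.measurableSet_cellSet K) (hcell K)]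
    refine (integral_finsetSum _ fun t _ =>
      integrable_finsetSum _ fun s _ => (hint K s t).const_mul _).trans ?_
    refine Finset.sum_congr rfl fun t _ => ?_
    rw [integral_finsetSum _ fun s _ => (hint K s t).const_mul _]
    refine Finset.sum_congr rfl fun s _ => ?_
    rw [integral_const_mul, ← sum_gradMatrix_mulVec h]
    simp
  rw [lhs]
  simp only [Matrix.mul_apply, Matrix.transpose_apply, Matrix.kroneckerMap_apply, coeffMatrix,
    Matrix.blockDiagonal_apply, Matrix.one_apply, Fintype.sum_prod_type, Finset.sum_mul]
  simp only [mul_ite, ite_mul, mul_one, mul_zero, zero_mul, Finset.sum_ite_eq',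
    Finset.mem_univ, if_true, Finset.mul_sum]
  rw [Finset.sum_comm]
  refine Finset.sum_congr rfl fun t _ => Finset.sum_congr rfl fun K _ => ?_
  rw [Finset.sum_comm]
  refine Finset.sum_congr rfl fun k _ => Finset.sum_congr rfl fun s _ => ?_
  -- The stiffness form applies `ρ` to the gradient of the row function, the matrix product to that
  -- of the column function; symmetry reconciles them.
  have := congrFun (congrFun (hsymm K) t) s
  rw [Matrix.transpose_apply] at this
  rw [← this]
  ring

end DDGeometry

/-! ### Bounds for partial derivatives -/

theorem integrable_profile {d : ℕ} (s t : Fin d) (l : ℕ) (b : ℝ) :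
    Integrable fun x => |profile s t (2 ^ l * x - b)| := by
  have h : Integrable fun x => |profile s t x| := by
    unfold profile
    split_ifs
    · exact integrable_abs_dhat
    · exact integrable_hat.abs
  exact (h.comp_sub_right b).comp_mul_left' (by positivity)

theorem integral_profile_le {d : ℕ} (s t : Fin d) (l : ℕ) (b : ℝ) :
    ∫ x, |profile s t (2 ^ l * x - b)| ≤ (2 ^ l)⁻¹ * if t = s then 2 else 1 := by
  have h : ∫ x, |profile s t x| ≤ if t = s then 2 else 1 := by
    unfold profile
    split_ifs
    · exact integral_abs_dhat_le
    · simp_rw [abs_of_nonneg (hat_nonneg _)]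
      exact integral_hat.le
  rw [Measure.integral_comp_mul_left (fun x => |profile s t (x - b)|),
    integral_sub_right_eq_self (fun x => |profile s t x|), smul_eq_mul, abs_of_pos (by positivity)]
  gcongr

theorem prod_ite_two {d : ℕ} (s : Fin d) (a : ℝ) :
    ∏ t : Fin d, (if t = s then a else 1) = a := by
  rw [Finset.prod_ite_eq' Finset.univ s fun _ => a, if_pos (Finset.mem_univ s)]

theorem abs_pder {d : ℕ} (l : ℕ) (b : Fin d → ℝ) (s : Fin d) (x : Fin d → ℝ) :
    |pder l b s x| = 2 ^ l * ∏ t, |profile s t (2 ^ l * x t - b t)| := by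
  rw [pder, abs_mul, abs_of_pos (by positivity), Finset.abs_prod]

theorem integrable_abs_pder {d : ℕ} (l : ℕ) (b : Fin d → ℝ) (s : Fin d) :
    Integrable fun x => |pder l b s x| := by
  simp_rw [abs_pder]
  exact (Integrable.fintype_prod (f := fun t x => |profile s t (2 ^ l * x - b t)|)
    fun t => integrable_profile s t l (b t)).const_mul _

/-- Column bound of the Schur test. By Fubini each direction contributes a mesh size, and the
differentiated one an extra factor 2, in front of the slope scale `2 ^ l`. -/
theorem integral_abs_pder_le {d : ℕ} (l : ℕ) (b : Fin d → ℝ) (s : Fin d) :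
    ∫ x, |pder l b s x| ≤ 2 * 2 ^ l * ((2 ^ l)⁻¹) ^ d := by
  simp_rw [abs_pder]
  rw [integral_const_mul, integral_fintype_prod_volume_eq_prod
    (fun t x => |profile s t (2 ^ l * x - b t)|)]
  calc (2 : ℝ) ^ l * ∏ t, ∫ x, |profile s t (2 ^ l * x - b t)|
      ≤ 2 ^ l * ∏ t : Fin d, ((2 ^ l)⁻¹ * if t = s then 2 else 1) := by
        refine mul_le_mul_of_nonneg_left (Finset.prod_le_prod
          (fun t _ => integral_nonneg fun x => abs_nonneg _)
          fun t _ => integral_profile_le s t l (b t)) (by positivity)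
    _ = _ := by
        rw [Finset.prod_mul_distrib, prod_ite_two]
        simp
        ring

theorem sum_prod_fin {d n : ℕ} (f : Fin d → Fin n → ℝ) :
    ∑ j : Fin d → Fin n, ∏ t, f t (j t) = ∏ t, ∑ i, f t i := by
  rw [Finset.prod_univ_sum, Fintype.piFinset_univ]

/-- Row bound of the Schur test, for one level and one subdomain. The sum over a tensor grid factors
into one-dimensional sums, bounded by 2 in direction `s` and by 1 in the others. -/
theorem sum_abs_pder_le {d n : ℕ} (l : ℕ) (b : Fin d → ℝ) (s : Fin d) (x : Fin d → ℝ) :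
    ∑ j : Fin d → Fin n, |pder l (fun t => b t + ((j t : ℕ) + 1)) s x| ≤ 2 * 2 ^ l := by
  simp_rw [abs_pder]
  rw [← Finset.mul_sum, sum_prod_fin fun t i => |profile s t (2 ^ l * x t - (b t + ((i : ℕ) + 1)))|,
    mul_comm]
  gcongr
  calc _ ≤ ∏ t : Fin d, (if t = s then (2 : ℝ) else 1) := by
        refine Finset.prod_le_prod (fun t _ => Finset.sum_nonneg fun _ _ => abs_nonneg _)
          fun t _ => ?_
        unfold profile
        simp_rw [← sub_sub _ (b t)]
        split_ifs
        · exact sum_fin_abs_dhat_le_two _ _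
        · simp_rw [abs_of_nonneg (hat_nonneg _)]
          exact sum_fin_hat_le_one _ _
    _ = 2 := prod_ite_two s 2

/-! ### The local part of the Schwarz factor -/

/-- The scaling factor of the level `l + 1` in the BPX factor. -/
def levelWeight (d l : ℕ) : ℝ := (2 : ℝ) ^ (-((l + 1 : ℕ) : ℝ) * (2 - (d : ℝ)) / 2)

/-- This balance of squared weight, squared slope and cell volume is the reason for the BPX
exponent: all levels contribute equally. -/
theorem levelWeight_sq (d l : ℕ) :
    levelWeight d l ^ 2 * (2 ^ (l + 1)) ^ 2 * ((2 ^ (l + 1))⁻¹) ^ d = 1 := by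
  have h2 : (0 : ℝ) < 2 := two_pos
  have e1 : ((2 : ℝ) ^ (l + 1)) ^ 2 = (2 : ℝ) ^ (((l + 1 : ℕ) : ℝ) * 2) := by
    rw [Real.rpow_mul h2.le, Real.rpow_natCast, ← Real.rpow_natCast _ 2]; norm_num
  have e2 : (((2 : ℝ) ^ (l + 1))⁻¹) ^ d = (2 : ℝ) ^ (-((l + 1 : ℕ) : ℝ) * d) := by
    rw [Real.rpow_mul h2.le, Real.rpow_neg h2.le, Real.rpow_natCast, Real.rpow_natCast]
  have e3 : levelWeight d l ^ 2 = (2 : ℝ) ^ (-((l + 1 : ℕ) : ℝ) * (2 - (d : ℝ))) := by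
    rw [levelWeight, ← Real.rpow_natCast _ 2, ← Real.rpow_mul h2.le]
    congr 1; push_cast; ring
  rw [e1, e2, e3, ← Real.rpow_add h2, ← Real.rpow_add h2]
  convert Real.rpow_zero 2 using 2
  ring

namespace DDGeometry

variable {d : ℕ} (G : DDGeometry d)

/-- The columns of the Schwarz factor that belong to the subdomains. -/
def localFactor : Matrix G.Vertex (G.Sub × BPXIndex d G.L) ℝ :=
  Matrix.of fun v c => ((G.restriction c.1)ᵀ * bpxFactor d G.L) v c.2

/-- The offset of the subdomain `i`, scaled by the mesh size of level `l`. -/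
def offset (l : ℕ) (i : G.Sub) (t : Fin d) : ℝ :=
  2 ^ l * (((i t : ℕ) * (2 ^ G.L - G.m) : ℕ) / 2 ^ G.L)

/-- The partial derivative in direction `s` of the function that belongs to a column of the
local part of the Schwarz factor. -/
def columnDer (a : G.Sub × BPXIndex d G.L) (s : Fin d) (y : Fin d → ℝ) : ℝ :=
  levelWeight d a.2.1 *
    pder (a.2.1 + 1) (fun t => G.offset (a.2.1 + 1) a.1 t + (((a.2.2 t : ℕ) : ℝ) + 1)) s y

variable {G}

theorem sum_localFactor_mul (a : G.Sub × BPXIndex d G.L) (f : G.Vertex → ℝ) :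
    ∑ v, G.localFactor v a * f v =
      ∑ w : CubeVertex d G.L, bpxFactor d G.L w a.2 * f (G.embed a.1 w) := by
  simp only [localFactor, Matrix.of_apply, Matrix.mul_apply, Matrix.transpose_apply, restriction,
    Matrix.submatrix_apply, id, Matrix.one_apply, ite_mul, one_mul, zero_mul, Finset.sum_mul]
  rw [Finset.sum_comm]
  simp

/-- The sum over fine vertices factors over the directions, and in each direction the refinement
relations collapse it to a single coarse profile, translated by the offset of the subdomain. -/
theorem gradSum_localFactor_col {K : G.Cell} {y : Fin d → ℝ} (hy : y ∈ G.cellSet K) (s : Fin d)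
    (a : G.Sub × BPXIndex d G.L) :
    ∑ v, G.localFactor v a * pder G.L (fun t => ((v t : ℕ) : ℝ) + 1) s y = G.columnDer a s y := by
  obtain ⟨i, l, j⟩ := a
  rw [sum_localFactor_mul]
  have hl : (l : ℕ) + 1 ≤ G.L := l.2
  have h1 : ∀ t, ∑ w : Fin (2 ^ G.L - 1),
      hat (2 ^ ((l : ℕ) + 1) * (((w : ℕ) + 1) / 2 ^ G.L) - ((j t : ℕ) + 1)) *
        profile s t (2 ^ G.L * y t - (((i t : ℕ) * (2 ^ G.L - G.m) + w : ℕ) + 1)) =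
      (if t = s then (2 : ℝ) ^ ((l : ℕ) + 1) / 2 ^ G.L else 1) *
        profile s t (2 ^ ((l : ℕ) + 1) * y t - (G.offset (l + 1) i t + (((j t : ℕ) : ℝ) + 1))) := by
    intro t
    have e1 : ∀ w : Fin (2 ^ G.L - 1),
        2 ^ G.L * y t - ((((i t : ℕ) * (2 ^ G.L - G.m) + w : ℕ) : ℝ) + 1) =
          (2 ^ G.L * y t - ((i t : ℕ) * (2 ^ G.L - G.m) : ℕ)) - ((w : ℕ) + 1) := fun w => by
      rw [Nat.cast_add]; ring
    have e2 : 2 ^ ((l : ℕ) + 1) * y t - (G.offset (l + 1) i t + (((j t : ℕ) : ℝ) + 1)) =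
        2 ^ ((l : ℕ) + 1) * ((2 ^ G.L * y t - ((i t : ℕ) * (2 ^ G.L - G.m) : ℕ)) / 2 ^ G.L) -
          ((j t : ℕ) + 1) := by
      rw [offset]; field_simp; ring
    simp_rw [e1]
    rw [e2]
    unfold profile
    split_ifs with hts
    · refine dhat_refinement hl (j t) fun z hz => ?_
      refine G.ne_intCast_of_mem_cellSet hy t (z + ((i t : ℕ) * (2 ^ G.L - G.m) : ℕ)) ?_
      rw [Int.cast_add, Int.cast_natCast]
      linarith
    · rw [one_mul]; exact hat_refinement hl (j t) _
  have h2 : ∀ w : CubeVertex d G.L, bpxFactor d G.L w ⟨l, j⟩ *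
      pder G.L (fun t => ((G.embed i w t : ℕ) : ℝ) + 1) s y = levelWeight d l * 2 ^ G.L *
      ∏ t, (hat (2 ^ ((l : ℕ) + 1) * (((w t : ℕ) + 1) / 2 ^ G.L) - ((j t : ℕ) + 1)) *
        profile s t (2 ^ G.L * y t - (((i t : ℕ) * (2 ^ G.L - G.m) + w t : ℕ) + 1))) := by
    intro w
    rw [Finset.prod_mul_distrib, pder, bpxFactor, Matrix.of_apply, levelEmbedding, Matrix.of_apply,
      nodalFun, levelWeight]
    simp only [embed, Nat.cast_add, Nat.cast_one]
    ring
  simp_rw [h2]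
  rw [← Finset.mul_sum, sum_prod_fin fun t (w : Fin (2 ^ G.L - 1)) =>
    hat (2 ^ ((l : ℕ) + 1) * (((w : ℕ) + 1) / 2 ^ G.L) - ((j t : ℕ) + 1)) *
        profile s t (2 ^ G.L * y t - (((i t : ℕ) * (2 ^ G.L - G.m) + w : ℕ) + 1))]
  simp_rw [h1]
  rw [Finset.prod_mul_distrib, prod_ite_two, columnDer, pder]
  field_simp

theorem gradSum_localFactor {K : G.Cell} {y : Fin d → ℝ} (hy : y ∈ G.cellSet K) (s : Fin d)
    (c : G.Sub × BPXIndex d G.L → ℝ) :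
    G.gradSum (G.localFactor *ᵥ c) s y = ∑ a, c a * G.columnDer a s y := by
  simp_rw [← gradSum_localFactor_col hy, gradSum, Matrix.mulVec, dotProduct, Finset.sum_mul,
    Finset.mul_sum]
  rw [Finset.sum_comm]
  exact Finset.sum_congr rfl fun a _ => Finset.sum_congr rfl fun v _ => by ring

/-- A Schur test: the squared gradient is dominated by a weighted sum of absolute values. -/
theorem sq_sum_columnDer_le (c : G.Sub × BPXIndex d G.L → ℝ) (s : Fin d) (y : Fin d → ℝ) :
    (∑ a, c a * G.columnDer a s y) ^ 2 ≤ (G.numSub * G.L) * ∑ a : G.Sub × BPXIndex d G.L,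
      c a ^ 2 * (levelWeight d a.2.1 ^ 2 * (2 * 2 ^ ((a.2.1 : ℕ) + 1))) *
        |pder (a.2.1 + 1) (fun t => G.offset (a.2.1 + 1) a.1 t + (((a.2.2 t : ℕ) : ℝ) + 1)) s y| := by
  -- The weights normalize the row bound to 1 for each pair of a subdomain and a level.
  have h1 : ∑ a : G.Sub × BPXIndex d G.L, (2 * 2 ^ ((a.2.1 : ℕ) + 1))⁻¹ *
      |pder (a.2.1 + 1) (fun t => G.offset (a.2.1 + 1) a.1 t + (((a.2.2 t : ℕ) : ℝ) + 1)) s y| ≤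
        (G.numSub * G.L : ℝ) := by
    rw [Fintype.sum_prod_type]
    calc _ ≤ ∑ _i : G.Sub, ∑ _l : Fin G.L, (1 : ℝ) := by
          refine Finset.sum_le_sum fun i _ => ?_
          rw [Fintype.sum_sigma]
          refine Finset.sum_le_sum fun l _ => ?_
          simp only
          rw [← Finset.mul_sum, inv_mul_le_iff₀ (by positivity), mul_one]
          exact sum_abs_pder_le _ _ _ _
      _ = _ := by simp [numSub]
  refine le_trans (Finset.sum_sq_le_sum_mul_sum_of_sq_le_mul Finset.univ
    (f := fun a : G.Sub × BPXIndex d G.L => (2 * 2 ^ ((a.2.1 : ℕ) + 1))⁻¹ *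
      |pder (a.2.1 + 1) (fun t => G.offset (a.2.1 + 1) a.1 t + (((a.2.2 t : ℕ) : ℝ) + 1)) s y|)
    (g := fun a => c a ^ 2 * (levelWeight d a.2.1 ^ 2 * (2 * 2 ^ ((a.2.1 : ℕ) + 1))) *
      |pder (a.2.1 + 1) (fun t => G.offset (a.2.1 + 1) a.1 t + (((a.2.2 t : ℕ) : ℝ) + 1)) s y|)
    (fun a _ => by positivity) (fun a _ => by positivity) fun a _ => ?_) ?_
  · rw [columnDer, mul_pow, mul_pow, ← sq_abs (pder _ _ _ _)]
    field_simp
    rfl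
  · exact mul_le_mul_of_nonneg_right h1 (Finset.sum_nonneg fun a _ => by positivity)

/-! ### Upper bound for the gradient of the local columns -/

variable {ψ : G.Cell → Fin (2 ^ d) → (Fin d → ℝ) → ℝ}

theorem sum_sq_gradMatrix_mulVec (h : G.IsDGBasis ψ) (x : G.Vertex → ℝ) :
    ∑ r, (G.gradMatrix ψ *ᵥ x) r ^ 2 = ∑ s, ∑ K, ∫ y in G.cellSet K, G.gradSum x s y ^ 2 := by
  rw [Fintype.sum_prod_type, Fintype.sum_prod_type]
  simp_rw [pow_two, sum_gradMatrix_mulVec h]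

theorem sum_sq_gradMatrix_localFactor_le (h : G.IsDGBasis ψ) (c : G.Sub × BPXIndex d G.L → ℝ) :
    ∑ r, (G.gradMatrix ψ *ᵥ (G.localFactor *ᵥ c)) r ^ 2 ≤
      4 * G.numSub * d * G.L * ∑ a, c a ^ 2 := by
  rw [sum_sq_gradMatrix_mulVec h]
  have key : ∀ s : Fin d, ∑ K, ∫ y in G.cellSet K, G.gradSum (G.localFactor *ᵥ c) s y ^ 2 ≤
      4 * G.numSub * G.L * ∑ a, c a ^ 2 := by
    intro s
    set F : (Fin d → ℝ) → ℝ := fun y => (G.numSub * G.L) * ∑ a : G.Sub × BPXIndex d G.L,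
      c a ^ 2 * (levelWeight d a.2.1 ^ 2 * (2 * 2 ^ ((a.2.1 : ℕ) + 1))) *
        |pder (a.2.1 + 1) (fun t => G.offset (a.2.1 + 1) a.1 t + (((a.2.2 t : ℕ) : ℝ) + 1)) s y|
      with hF
    have hFi : ∀ a ∈ (Finset.univ : Finset (G.Sub × BPXIndex d G.L)), Integrable fun y =>
        c a ^ 2 * (levelWeight d a.2.1 ^ 2 * (2 * 2 ^ ((a.2.1 : ℕ) + 1))) *
        |pder (a.2.1 + 1) (fun t => G.offset (a.2.1 + 1) a.1 t + (((a.2.2 t : ℕ) : ℝ) + 1)) s y| :=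
      fun a _ => (integrable_abs_pder _ _ _).const_mul _
    have hFint : Integrable F := (integrable_finsetSum _ hFi).const_mul _
    calc ∑ K, ∫ y in G.cellSet K, G.gradSum (G.localFactor *ᵥ c) s y ^ 2
        ≤ ∑ K, ∫ y in G.cellSet K, F y := by
          refine Finset.sum_le_sum fun K _ => ?_
          refine setIntegral_mono_on ?_ hFint.integrableOn (G.measurableSet_cellSet K)
            fun y hy => by
              rw [gradSum_localFactor hy]; exact sq_sum_columnDer_le c s y
          obtain ⟨q, hq, hqe⟩ := G.exists_QOne_gradSum K (G.localFactor *ᵥ c) s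
          refine (G.integrableOn_cellSet ((continuous_of_mem_QOne hq).pow 2) K).congr_fun
            (fun y hy => ?_) (G.measurableSet_cellSet K)
          simp only [hqe y hy, Pi.pow_apply]
      _ ≤ ∫ y, F y := G.sum_setIntegral_cellSet_le (fun y => by
          simp only [hF, Pi.zero_apply]; positivity) hFint
      _ = (G.numSub * G.L) * ∑ a : G.Sub × BPXIndex d G.L,
            c a ^ 2 * (levelWeight d a.2.1 ^ 2 * (2 * 2 ^ ((a.2.1 : ℕ) + 1))) *
            ∫ y, |pder (a.2.1 + 1)
              (fun t => G.offset (a.2.1 + 1) a.1 t + (((a.2.2 t : ℕ) : ℝ) + 1)) s y| := by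
          rw [hF, integral_const_mul, integral_finsetSum _ hFi]
          simp_rw [integral_const_mul]
      _ ≤ (G.numSub * G.L) * ∑ a : G.Sub × BPXIndex d G.L, 4 * c a ^ 2 := by
          refine mul_le_mul_of_nonneg_left (Finset.sum_le_sum fun a _ => ?_) (by positivity)
          refine (mul_le_mul_of_nonneg_left (integral_abs_pder_le _ _ _)
            (by positivity)).trans_eq ?_
          -- One factor 2 comes from the row bound and one from the column bound; the powers of two
          -- cancel.
          linear_combination 4 * c a ^ 2 * levelWeight_sq d a.2.1
      _ = _ := by rw [← Finset.mul_sum]; ring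
  calc _ ≤ ∑ _s : Fin d, 4 * G.numSub * G.L * ∑ a, c a ^ 2 := Finset.sum_le_sum fun s _ => key s
    _ = _ := by simp; ring

end DDGeometry

/-! ### An oscillating test function -/

/-- The indicator of the interior vertices `1, …, n` of a grid on an interval. -/
def interiorInd (n k : ℕ) : ℝ := if 1 ≤ k ∧ k ≤ n then 1 else 0

theorem sum_fin_hat (n k : ℕ) {y : ℝ} (h1 : (k : ℝ) < y) (h2 : y < k + 1) :
    ∑ j : Fin n, hat (y - ((j : ℕ) + 1)) =
      interiorInd n k * (k + 1 - y) + interiorInd n (k + 1) * (y - k) := by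
  have h := sum_fin_eq_sum_Icc (n := n)
    (fun z : ℤ => (if z ∈ Finset.Icc (1 : ℤ) n then (1 : ℝ) else 0) * hat (y - z))
  have hfl : ⌊y⌋ = (k : ℤ) := Int.floor_eq_iff.2 ⟨by push_cast; exact h1.le, by push_cast; exact h2⟩
  rw [sum_mul_hat (Finset.Icc (1 : ℤ) n) (fun z => if z ∈ Finset.Icc (1 : ℤ) n then 1 else 0)
    (fun z hz => if_neg hz), hfl] at h
  have e : ∀ j : Fin n, ((j : ℕ) : ℤ) + 1 ∈ Finset.Icc (1 : ℤ) n := fun j => by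
    have := j.2
    simp only [Finset.mem_Icc]; omega
  simp only [e, if_true, one_mul] at h
  push_cast at h
  rw [h]
  congr 2
  · unfold interiorInd
    congr 1
    simp only [Finset.mem_Icc]
    apply propext; omega
  · unfold interiorInd
    congr 1
    simp only [Finset.mem_Icc]
    apply propext; omega

/-- On the cell `(k, k + 1)` the hat of vertex `k` falls and that of vertex `k + 1` rises;
alternating signs make the two slopes add instead of cancel. -/
theorem sum_fin_alternating_dhat (n k : ℕ) {y : ℝ} (h1 : (k : ℝ) < y) (h2 : y < k + 1) :
    ∑ j : Fin n, (-1) ^ (j : ℕ) * dhat (y - ((j : ℕ) + 1)) =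
      (-1) ^ k * (interiorInd n k + interiorInd n (k + 1)) := by
  have hterm : ∀ j : ℕ, (-1 : ℝ) ^ j * dhat (y - (j + 1)) =
      (if k = j then (-1) ^ k else 0) + if k = j + 1 then (-1) ^ k else 0 := by
    intro j
    have := dhat_sub_intCast k (j + 1) (y := y) (by exact_mod_cast h1) (by exact_mod_cast h2)
    push_cast at this
    have e1 : ((k : ℝ) + 1 - (j + 1)) = (((k : ℤ) - j : ℤ) : ℝ) := by push_cast; ring
    have e2 : ((k : ℝ) - (j + 1)) = (((k : ℤ) - (j + 1) : ℤ) : ℝ) := by push_cast; ring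
    rw [this, e1, e2, hat_intCast, hat_intCast]
    by_cases ha : k = j
    · subst ha; simp
    · by_cases hb : k = j + 1
      · subst hb; simp [pow_succ]
      · rw [if_neg (by omega), if_neg (by omega), if_neg ha, if_neg hb]; simp
  simp_rw [hterm]
  rw [Finset.sum_add_distrib, mul_add, add_comm]
  congr 1
  · rw [Fin.sum_univ_eq_sum_range (fun j => if k = j + 1 then (-1 : ℝ) ^ k else 0)]
    cases k with
    | zero => simp [interiorInd]
    | succ m =>
      simp only [add_left_inj, Finset.sum_ite_eq, Finset.mem_range,
        interiorInd, mul_ite, mul_one, mul_zero]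
      congr 1
      apply propext; omega
  · rw [Fin.sum_univ_eq_sum_range (fun j => if k = j then (-1 : ℝ) ^ k else 0)]
    simp only [Finset.sum_ite_eq, Finset.mem_range, interiorInd, mul_ite, mul_one, mul_zero]
    congr 1
    apply propext; omega

/-- The `n - 1` cells between interior vertices contribute 1 each, the two end cells 1/4 each. -/
theorem sum_interiorInd_sq {n N : ℕ} (hn : 1 ≤ n) (hN : n + 1 ≤ N) :
    (n : ℝ) - 1 / 2 ≤ ∑ k : Fin N, ((interiorInd n k + interiorInd n (k + 1)) / 2) ^ 2 := by
  rw [Fin.sum_univ_eq_sum_range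
    (fun k => ((interiorInd n k + interiorInd n (k + 1)) / 2) ^ 2)]
  refine le_trans ?_ (Finset.sum_le_sum_of_subset_of_nonneg (Finset.range_subset_range.2 hN)
    fun _ _ _ => sq_nonneg _)
  obtain ⟨m, rfl⟩ := Nat.exists_eq_add_of_le' hn
  rw [Finset.sum_range_succ, Finset.sum_range_succ']
  have e1 : ∀ k ∈ Finset.range m,
      ((interiorInd (m + 1) (k + 1) + interiorInd (m + 1) (k + 1 + 1)) / 2) ^ 2 = (1 : ℝ) := by
    intro k hk
    have := Finset.mem_range.1 hk
    unfold interiorInd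
    rw [if_pos (by omega), if_pos (by omega)]; norm_num
  rw [Finset.sum_congr rfl e1]
  have e2 : interiorInd (m + 1) 0 = 0 := by simp [interiorInd]
  have e3 : interiorInd (m + 1) (0 + 1) = 1 := by simp [interiorInd]
  have e4 : interiorInd (m + 1) (m + 1) = 1 := by simp [interiorInd]
  have e5 : interiorInd (m + 1) (m + 1 + 1) = 0 := by simp [interiorInd]
  rw [e2, e3, e4, e5]
  simp
  norm_num
  linarith

/-- Jensen's inequality: the mean of the square is at least the square of the mean, which is the
midpoint value of the affine function. -/
theorem le_integral_affine_sq (L k : ℕ) (a b : ℝ) :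
    (2 ^ L)⁻¹ * ((a + b) / 2) ^ 2 ≤
      ∫ x in Set.Ioo ((k : ℝ) / 2 ^ L) (((k : ℝ) + 1) / 2 ^ L),
        (a * (k + 1 - 2 ^ L * x) + b * (2 ^ L * x - k)) ^ 2 := by
  have hp : (0 : ℝ) < 2 ^ L := by positivity
  rw [← integral_Ioc_eq_integral_Ioo, ← intervalIntegral.integral_of_le (by gcongr; linarith)]
  have e : ∀ x : ℝ, (a * (k + 1 - 2 ^ L * x) + b * (2 ^ L * x - k)) ^ 2 =
      (fun u : ℝ => a ^ 2 + 2 * a * (b - a) * u + (b - a) ^ 2 * u ^ 2) (2 ^ L * x - k) := fun x => by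
    beta_reduce; ring
  simp_rw [e]
  rw [intervalIntegral.integral_comp_mul_sub (fun u : ℝ =>
    a ^ 2 + 2 * a * (b - a) * u + (b - a) ^ 2 * u ^ 2) hp.ne', smul_eq_mul]
  have b1 : (2 : ℝ) ^ L * (k / 2 ^ L) - k = 0 := by field_simp; ring
  have b2 : (2 : ℝ) ^ L * ((k + 1) / 2 ^ L) - k = 1 := by field_simp; ring
  rw [b1, b2, intervalIntegral.integral_add (Continuous.intervalIntegrable (by fun_prop) _ _)
    (Continuous.intervalIntegrable (by fun_prop) _ _),
    intervalIntegral.integral_add (Continuous.intervalIntegrable (by fun_prop) _ _)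
    (Continuous.intervalIntegrable (by fun_prop) _ _), intervalIntegral.integral_const_mul,
    intervalIntegral.integral_const_mul, integral_id, integral_pow, intervalIntegral.integral_const]
  gcongr
  norm_num
  nlinarith [sq_nonneg (b - a)]

/-- The factor in direction `t` of the test function, differentiated if `t = s`. -/
def testProfile {d : ℕ} (n : ℕ) (s t : Fin d) (y : ℝ) : ℝ :=
  ∑ j : Fin n, (if t = s then (-1) ^ (j : ℕ) else 1) * profile s t (y - ((j : ℕ) + 1))

/-- The differentiated factor is, up to sign, twice the midpoint value of the undifferentiated one,
hence the 4; one estimate then serves all directions. -/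
theorem exists_testProfile_eq {d : ℕ} (n : ℕ) (s t : Fin d) (k : ℕ) :
    ∃ a b : ℝ, (∀ y : ℝ, (k : ℝ) < y → y < k + 1 →
      testProfile n s t y = a * (k + 1 - y) + b * (y - k)) ∧
      ((a + b) / 2) ^ 2 = (if t = s then 4 else 1) *
        ((interiorInd n k + interiorInd n (k + 1)) / 2) ^ 2 := by
  by_cases h : t = s
  · refine ⟨(-1) ^ k * (interiorInd n k + interiorInd n (k + 1)),
      (-1) ^ k * (interiorInd n k + interiorInd n (k + 1)), fun y h1 h2 => ?_, ?_⟩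
    · simp only [testProfile, profile, if_pos h]
      rw [sum_fin_alternating_dhat n k h1 h2]; ring
    · rw [if_pos h, add_self_div_two, mul_pow, ← pow_mul, mul_comm k 2, pow_mul]
      norm_num
      ring
  · refine ⟨interiorInd n k, interiorInd n (k + 1), fun y h1 h2 => ?_, ?_⟩
    · simp only [testProfile, profile, if_neg h, one_mul]
      exact sum_fin_hat n k h1 h2
    · rw [if_neg h, one_mul]

theorem le_sum_integral_testProfile_sq {d n L N : ℕ} (hn : 1 ≤ n) (hN : n + 1 ≤ N) (s t : Fin d) :
    (if t = s then 4 else 1) * (((n : ℝ) - 1 / 2) * (2 ^ L)⁻¹) ≤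
      ∑ k : Fin N, ∫ x in Set.Ioo (((k : ℕ) : ℝ) / 2 ^ L) ((((k : ℕ) : ℝ) + 1) / 2 ^ L),
        testProfile n s t (2 ^ L * x) ^ 2 := by
  have h1 : ∀ k : ℕ, (2 ^ L)⁻¹ * ((if t = s then 4 else 1) *
      ((interiorInd n k + interiorInd n (k + 1)) / 2) ^ 2) ≤
      ∫ x in Set.Ioo ((k : ℝ) / 2 ^ L) (((k : ℝ) + 1) / 2 ^ L),
        testProfile n s t (2 ^ L * x) ^ 2 := by
    intro k
    obtain ⟨a, b, hab, he⟩ := exists_testProfile_eq n s t k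
    rw [← he]
    refine (le_integral_affine_sq L k a b).trans_eq
      (setIntegral_congr_fun measurableSet_Ioo fun x hx => ?_)
    have hp : (0 : ℝ) < 2 ^ L := by positivity
    have h1 := hx.1
    have h2 := hx.2
    rw [div_lt_iff₀ hp] at h1
    rw [lt_div_iff₀ hp] at h2
    rw [hab _ (by linarith) (by linarith)]
  calc _ ≤ (if t = s then 4 else 1) *
        ((∑ k : Fin N, ((interiorInd n k + interiorInd n (k + 1)) / 2) ^ 2) * (2 ^ L)⁻¹) := by
        gcongr
        exact sum_interiorInd_sq hn hN
    _ = ∑ k : Fin N, (2 ^ L)⁻¹ * ((if t = s then 4 else 1) *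
          ((interiorInd n k + interiorInd n (k + 1)) / 2) ^ 2) := by
        rw [← Finset.mul_sum, ← Finset.mul_sum]; ring
    _ ≤ _ := Finset.sum_le_sum fun k _ => h1 k

/-- With `x = 1 / L ≤ 1` this follows from `(1 + x)^d ≤ 1 + (2^d - 1) x`. The induction needs the
sharper constant `2^d - 1`. -/
theorem div_add_two_pow_le (L d : ℕ) (hL : 1 ≤ L) :
    (L : ℝ) / (L + 2 ^ d) ≤ ((L : ℝ) / (L + 1)) ^ d := by
  have hL' : (1 : ℝ) ≤ L := by exact_mod_cast hL
  have h2 : ∀ d : ℕ, (1 : ℝ) ≤ 2 ^ d := fun d => one_le_pow₀ (by norm_num)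
  have hpos : ∀ d : ℕ, (0 : ℝ) < L + (2 ^ d - 1) := fun d => by linarith [h2 d]
  have key : (L : ℝ) / (L + (2 ^ d - 1)) ≤ ((L : ℝ) / (L + 1)) ^ d := by
    induction d with
    | zero =>
      have : (L : ℝ) ≠ 0 := by linarith
      simp [this]
    | succ d ih =>
      rw [pow_succ ((L : ℝ) / (L + 1))]
      refine le_trans ?_ (mul_le_mul_of_nonneg_right ih (by positivity))
      rw [div_mul_div_comm, div_le_div_iff₀ (hpos _) (mul_pos (hpos d) (by linarith)), mul_assoc]
      refine mul_le_mul_of_nonneg_left ?_ (by linarith)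
      rw [pow_succ]
      nlinarith [mul_nonneg (sub_nonneg.2 (h2 d)) (sub_nonneg.2 hL')]
  refine le_trans ?_ key
  gcongr
  · exact hpos d
  · linarith

namespace DDGeometry

variable {d : ℕ} {G : DDGeometry d}

theorem setIntegral_cellSet_prod (K : G.Cell) (f : Fin d → ℝ → ℝ) :
    ∫ x in G.cellSet K, ∏ t, f t (x t) = ∏ t, ∫ x in
      Set.Ioo (((K t : ℕ) : ℝ) / 2 ^ G.L) ((((K t : ℕ) : ℝ) + 1) / 2 ^ G.L), f t x := by
  rw [cellSet, volume_pi, Measure.restrict_pi_pi]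
  exact integral_fintype_prod_eq_prod f

theorem two_pow_le_cells (t : Fin d) : 2 ^ G.L ≤ G.cells t := Nat.le_add_right _ _

variable {ψ : G.Cell → Fin (2 ^ d) → (Fin d → ℝ) → ℝ}

/-- The gradient of the local part of the Schwarz factor is large on an oscillating function of
the finest level. -/
theorem exists_le_sum_sq_gradMatrix_localFactor (h : G.IsDGBasis ψ) (s : Fin d) :
    ∃ c : G.Sub × BPXIndex d G.L → ℝ, 0 < ∑ a, c a ^ 2 ∧
      4 * (G.L / (G.L + 2 ^ d)) * ∑ a, c a ^ 2 ≤
        ∑ r, (G.gradMatrix ψ *ᵥ (G.localFactor *ᵥ c)) r ^ 2 := by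
  obtain ⟨l, hl⟩ := Nat.exists_eq_add_of_le' G.one_le_L
  set n : ℕ := 2 ^ (l + 1) - 1 with hn
  have hpow : l + 1 < 2 ^ (l + 1) := Nat.lt_two_pow_self
  have hn1 : G.L ≤ n := by omega
  have hL1 := G.one_le_L
  have hL2 : (2 : ℝ) ^ (l + 1) = 2 ^ G.L := by rw [hl]
  let i₀ : G.Sub := fun t => ⟨0, G.one_le_N t⟩
  let e : CubeVertex d (l + 1) → G.Sub × BPXIndex d G.L := fun j => (i₀, ⟨⟨l, by omega⟩, j⟩)
  have he : Function.Injective e := by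
    intro j j' hjj
    have := (Prod.ext_iff.1 hjj).2
    simpa [e] using this
  -- The test vector lives on the finest level of the subdomain at the origin, whose offset is zero,
  -- and alternates in direction `s` only.
  let b : CubeVertex d (l + 1) → ℝ := fun j => (-1) ^ (j s : ℕ)
  let c : G.Sub × BPXIndex d G.L → ℝ := Function.extend e b fun _ => 0
  have hce : ∀ j, c (e j) = b j := he.extend_apply b _
  have hc0 : ∀ a, a ∉ Set.range e → c a = 0 := fun a ha =>
    Function.extend_apply' b _ a fun ⟨j, hj⟩ => ha ⟨j, hj⟩
  have hcsum : ∑ a, c a ^ 2 = (n : ℝ) ^ d := by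
    rw [← Fintype.sum_of_injective e he (fun j => b j ^ 2) (fun a => c a ^ 2)
      (fun a ha => by rw [hc0 a ha]; norm_num) fun j => by rw [hce]]
    have : ∀ j, b j ^ 2 = 1 := fun j => by simp only [b]; rw [← pow_mul, mul_comm, pow_mul]; simp
    simp [this, hn]
  have hnpos : (1 : ℝ) ≤ n := by exact_mod_cast hL1.trans hn1
  refine ⟨c, by rw [hcsum]; positivity, ?_⟩
  have hcell : ∀ K, ∀ y ∈ G.cellSet K, G.gradSum (G.localFactor *ᵥ c) s y ^ 2 =
      (levelWeight d l * 2 ^ G.L) ^ 2 * ∏ t, testProfile n s t (2 ^ G.L * y t) ^ 2 := by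
    intro K y hy
    rw [gradSum_localFactor hy, ← Fintype.sum_of_injective e he
      (fun j => b j * G.columnDer (e j) s y) (fun a => c a * G.columnDer a s y)
      (fun a ha => by rw [hc0 a ha, zero_mul]) fun j => by rw [hce], Finset.prod_pow, ← mul_pow]
    congr 1
    unfold testProfile
    rw [← sum_prod_fin, Finset.mul_sum]
    refine Finset.sum_congr rfl fun j _ => ?_
    rw [Finset.prod_mul_distrib, Finset.prod_ite_eq' Finset.univ s fun t => (-1 : ℝ) ^ (j t : ℕ),
      if_pos (Finset.mem_univ s), columnDer, pder]
    simp only [e, b, offset, i₀, zero_mul, Nat.cast_zero, zero_div, mul_zero, zero_add, hL2]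
    ring
  rw [sum_sq_gradMatrix_mulVec h]
  calc 4 * (G.L / (G.L + 2 ^ d)) * ∑ a, c a ^ 2
      ≤ 4 * ((n : ℝ) - 1 / 2) ^ d := by
        rw [hcsum, mul_assoc]
        refine mul_le_mul_of_nonneg_left ?_ (by norm_num)
        refine (mul_le_mul_of_nonneg_right (div_add_two_pow_le G.L d hL1)
          (by positivity)).trans ?_
        rw [← mul_pow]
        refine pow_le_pow_left₀ (by positivity) ?_ d
        have hLn : (G.L : ℝ) ≤ n := by exact_mod_cast hn1
        -- The claim `n L / (L + 1) ≤ n - 1/2` amounts to `L + 1 ≤ 2 n`.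
        rw [div_mul_eq_mul_div, div_le_iff₀ (by positivity)]
        nlinarith
    _ = (levelWeight d l * 2 ^ G.L) ^ 2 *
          ∏ t : Fin d, (if t = s then 4 else 1) * (((n : ℝ) - 1 / 2) * (2 ^ G.L)⁻¹) := by
        rw [Finset.prod_mul_distrib, prod_ite_two, Finset.prod_const, Finset.card_univ,
          Fintype.card_fin, mul_pow, mul_pow, ← hL2]
        linear_combination -(4 * ((n : ℝ) - 1 / 2) ^ d) * levelWeight_sq d l
    _ ≤ (levelWeight d l * 2 ^ G.L) ^ 2 * ∏ t : Fin d, ∑ k : Fin (G.cells t),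
          ∫ x in Set.Ioo (((k : ℕ) : ℝ) / 2 ^ G.L) ((((k : ℕ) : ℝ) + 1) / 2 ^ G.L),
            testProfile n s t (2 ^ G.L * x) ^ 2 := by
        refine mul_le_mul_of_nonneg_left (Finset.prod_le_prod (fun t _ => ?_) fun t _ => ?_)
          (sq_nonneg _)
        · have : (0 : ℝ) ≤ (n : ℝ) - 1 / 2 := by linarith
          split_ifs <;> positivity
        · refine le_sum_integral_testProfile_sq (hL1.trans hn1) ?_ s t
          have := two_pow_le_cells (G := G) t
          rw [hl] at this
          omega
    _ = ∑ K, ∫ y in G.cellSet K, G.gradSum (G.localFactor *ᵥ c) s y ^ 2 := by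
        rw [Finset.prod_univ_sum, Fintype.piFinset_univ, Finset.mul_sum]
        refine Finset.sum_congr rfl fun K _ => ?_
        rw [setIntegral_congr_fun (G.measurableSet_cellSet K) (hcell K), integral_const_mul,
          setIntegral_cellSet_prod K fun t x => testProfile n s t (2 ^ G.L * x) ^ 2]
    _ ≤ _ := Finset.single_le_sum
        (f := fun s => ∑ K, ∫ y in G.cellSet K, G.gradSum (G.localFactor *ᵥ c) s y ^ 2)
        (fun s _ => Finset.sum_nonneg fun K _ => integral_nonneg fun y => sq_nonneg _)
        (Finset.mem_univ s)

/-! ### Injectivity of the gradient -/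

theorem gradSum_eq_zero (h : G.IsDGBasis ψ) {x : G.Vertex → ℝ} (hx : G.gradMatrix ψ *ᵥ x = 0)
    (s : Fin d) (K : G.Cell) {y : Fin d → ℝ} (hy : y ∈ G.cellSet K) : G.gradSum x s y = 0 := by
  obtain ⟨q, hq, hqe⟩ := G.exists_QOne_gradSum K x s
  have h0 : ∀ k, ∫ y in G.cellSet K, q y * ψ K k y = 0 := fun k => by
    have h1 := gradMatrix_mulVec h x s K k
    rw [hx, Pi.zero_apply] at h1
    rw [h1]
    exact setIntegral_congr_fun (G.measurableSet_cellSet K) fun y hy => by simp only [hqe y hy]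
  rw [hqe y hy, h.expansion K hq y]
  simp [h0]

/-- A vanishing derivative in direction `s` carries the zero boundary value along each grid line.
Nodal values are eliminated by induction on the coordinate in that direction. -/
theorem gradMatrix_mulVec_injective (h : G.IsDGBasis ψ) (s : Fin d) {x : G.Vertex → ℝ}
    (hx : G.gradMatrix ψ *ᵥ x = 0) : x = 0 := by
  suffices H : ∀ k : ℕ, ∀ v : G.Vertex, (v s : ℕ) = k → x v = 0 from funext fun v => H _ v rfl
  intro k
  induction k using Nat.strong_induction_on with
  | _ k ih =>
  intro v hv
  have hp : (0 : ℝ) < 2 ^ G.L := by positivity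
  -- At `ε = 0` this is the midpoint of the edge that ends at `v` in direction `s`. Only the two
  -- ends of the edge contribute there, and the earlier one is known to vanish. The edge lies on
  -- cell boundaries, so it is approached from inside a cell.
  let p : ℝ → Fin d → ℝ := fun ε t =>
    if t = s then ((k : ℝ) + 1 / 2) / 2 ^ G.L else (((v t : ℕ) : ℝ) + 1 + ε) / 2 ^ G.L
  have hps : ∀ ε, 2 ^ G.L * p ε s = (k : ℝ) + 1 / 2 := fun ε => by
    simp only [p, if_true]; field_simp
  have hpt : ∀ ε t, t ≠ s → 2 ^ G.L * p ε t = ((v t : ℕ) : ℝ) + 1 + ε := fun ε t ht => by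
    simp only [p, if_neg ht]; field_simp
  let K : G.Cell := fun t => if t = s then ⟨v t, by have := (v t).2; omega⟩
    else ⟨v t + 1, by have := (v t).2; omega⟩
  have hzero : ∀ ε ∈ Set.Ioo (0 : ℝ) 1, G.gradSum x s (p ε) = 0 := by
    intro ε hε
    refine gradSum_eq_zero h hx s K fun t _ => ?_
    by_cases ht : t = s
    · subst ht
      simp only [K, p, if_true, hv]
      constructor <;> gcongr <;> linarith
    · simp only [K, p, if_neg ht]
      push_cast
      exact ⟨div_lt_div_of_pos_right (by linarith [hε.1]) hp,
        div_lt_div_of_pos_right (by linarith [hε.2]) hp⟩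
  have hcont : Continuous fun ε => G.gradSum x s (p ε) := by
    unfold gradSum pder
    refine continuous_finsetSum _ fun w _ => continuous_const.mul (continuous_const.mul
      (continuous_finsetProd _ fun t _ => ?_))
    by_cases ht : t = s
    · subst ht
      simp_rw [hps]
      exact continuous_const
    · simp_rw [hpt _ t ht]
      rw [profile, if_neg ht]
      exact continuous_hat.comp (by fun_prop)
  have h0 : G.gradSum x s (p 0) = 0 := by
    have hcl : (0 : ℝ) ∈ closure (Set.Ioo (0 : ℝ) 1) := by
      rw [closure_Ioo (by norm_num)]; simp
    exact (isClosed_eq hcont continuous_const).closure_subset_iff.2 (fun ε hε => hzero ε hε) hcl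
  rw [gradSum, Finset.sum_eq_single v] at h0
  · rcases mul_eq_zero.1 h0 with h0 | h0
    · exact h0
    · exfalso
      revert h0
      rw [pder]
      refine mul_ne_zero hp.ne' (Finset.prod_ne_zero_iff.2 fun t _ => ?_)
      by_cases ht : t = s
      · subst ht
        rw [hps, hv, profile, if_pos rfl, dhat, if_pos (by constructor <;> linarith)]
        norm_num
      · rw [hpt _ t ht, profile, if_neg ht, add_zero, sub_self, hat_zero]
        norm_num
  · intro w _ hw
    by_cases hws : ∃ t, t ≠ s ∧ w t ≠ v t
    · obtain ⟨t, ht, hwt⟩ := hws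
      rw [pder, Finset.prod_eq_zero (Finset.mem_univ t), mul_zero, mul_zero]
      rw [hpt _ t ht, profile, if_neg ht]
      have e : ((v t : ℕ) : ℝ) + 1 + 0 - (((w t : ℕ) : ℝ) + 1) =
          ((((v t : ℕ) : ℤ) - ((w t : ℕ) : ℤ) : ℤ) : ℝ) := by push_cast; ring
      rw [e, hat_intCast, if_neg]
      intro h'
      exact hwt (Fin.ext (by omega))
    · push Not at hws
      have hne : (w s : ℕ) ≠ k := by
        intro hk
        refine hw (funext fun t => ?_)
        by_cases ht : t = s
        · subst ht; exact Fin.ext (by omega)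
        · exact hws t ht
      rcases lt_or_gt_of_ne hne with hlt | hgt
      · rw [ih _ hlt w rfl, zero_mul]
      · rw [pder, Finset.prod_eq_zero (Finset.mem_univ s), mul_zero, mul_zero]
        rw [hps, profile, if_pos rfl, dhat_eq_zero_of_one_le_abs]
        have : (k : ℝ) + 1 ≤ (w s : ℕ) := by exact_mod_cast hgt
        exact le_abs.2 (Or.inr (by linarith))
  · intro hv'; exact absurd (Finset.mem_univ v) hv'

end DDGeometry

/-! ### Spectral norms -/

theorem l2_opNorm_le_of_sum_sq_le {m n : Type*} [Fintype m] [Fintype n] [DecidableEq n]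
    (A : Matrix m n ℂ) {c : ℝ} (hc : 0 ≤ c)
    (h : ∀ x : n → ℂ, ∑ i, ‖(A *ᵥ x) i‖ ^ 2 ≤ c ^ 2 * ∑ j, ‖x j‖ ^ 2) : ‖A‖ ≤ c := by
  rw [Matrix.l2_opNorm_def]
  refine ContinuousLinearMap.opNorm_le_bound _ hc fun x => ?_
  refine le_of_sq_le_sq ?_ (by positivity)
  rw [mul_pow, EuclideanSpace.norm_sq_eq, EuclideanSpace.norm_sq_eq]
  exact h x

theorem sum_sq_mulVec_le {m n : Type*} [Fintype m] [Fintype n] [DecidableEq n]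
    (A : Matrix m n ℂ) (x : n → ℂ) : ∑ i, ‖(A *ᵥ x) i‖ ^ 2 ≤ ‖A‖ ^ 2 * ∑ j, ‖x j‖ ^ 2 := by
  have h := pow_le_pow_left₀ (norm_nonneg _) (Matrix.l2_opNorm_mulVec A (WithLp.toLp 2 x)) 2
  rwa [mul_pow, EuclideanSpace.norm_sq_eq, EuclideanSpace.norm_sq_eq] at h

theorem l2_opNorm_kronecker_one_le {m n o : Type*} [Fintype m] [Fintype n] [Fintype o]
    [DecidableEq n] [DecidableEq o] (A : Matrix m n ℂ) :
    ‖A ⊗ₖ (1 : Matrix o o ℂ)‖ ≤ ‖A‖ := by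
  refine l2_opNorm_le_of_sum_sq_le _ (norm_nonneg _) fun x => ?_
  have e : ∀ i k, ((A ⊗ₖ (1 : Matrix o o ℂ)) *ᵥ x) (i, k) = (A *ᵥ fun j => x (j, k)) i := by
    intro i k
    simp [Matrix.mulVec, dotProduct, Fintype.sum_prod_type, Matrix.one_apply]
  rw [Fintype.sum_prod_type_right, Fintype.sum_prod_type_right, Finset.mul_sum]
  refine Finset.sum_le_sum fun k _ => ?_
  simp_rw [e]
  exact sum_sq_mulVec_le A _

theorem toC_mul {m n o : Type*} [Fintype n] (A : Matrix m n ℝ) (B : Matrix n o ℝ) :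
    toC (A * B) = toC A * toC B := Matrix.map_mul (f := Complex.ofRealHom)

theorem toC_transpose {m n : Type*} (A : Matrix m n ℝ) : toC Aᵀ = (toC A)ᴴ := by
  ext i j; simp [toC]

theorem toC_kronecker_one {m n o : Type*} [DecidableEq o] (A : Matrix m n ℝ) :
    toC (A ⊗ₖ (1 : Matrix o o ℝ)) = toC A ⊗ₖ (1 : Matrix o o ℂ) := by
  ext ⟨i, k⟩ ⟨j, k'⟩
  by_cases h : k = k' <;> simp [toC, h]

theorem toC_one {n : Type*} [DecidableEq n] : toC (1 : Matrix n n ℝ) = 1 := by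
  ext i j
  by_cases h : i = j <;> simp [toC, Matrix.one_apply, h]

theorem toC_fromCols {m n o : Type*} (A : Matrix m n ℝ) (B : Matrix m o ℝ) :
    toC (Matrix.fromCols A B) = Matrix.fromCols (toC A) (toC B) := by
  ext i (j | j) <;> simp [toC]

theorem sum_sq_mulVec_le_toC {m n : Type*} [Fintype m] [Fintype n] [DecidableEq n]
    (A : Matrix m n ℝ) (x : n → ℝ) : ∑ i, (A *ᵥ x) i ^ 2 ≤ ‖toC A‖ ^ 2 * ∑ j, x j ^ 2 := by
  have h := sum_sq_mulVec_le (toC A) (fun j => (x j : ℂ))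
  have e : ∀ i, (toC A *ᵥ fun j => (x j : ℂ)) i = ((A *ᵥ x) i : ℝ) := fun i => by
    simp [toC, Matrix.mulVec, dotProduct]
  simp_rw [e, Complex.norm_real, Real.norm_eq_abs, sq_abs] at h
  exact h

/-- A real matrix acts separately on real and imaginary parts, so real test vectors suffice. -/
theorem toC_norm_sq_le {m n : Type*} [Fintype m] [Fintype n] [DecidableEq n]
    (A : Matrix m n ℝ) {c : ℝ} (hc : 0 ≤ c)
    (h : ∀ x : n → ℝ, ∑ i, (A *ᵥ x) i ^ 2 ≤ c * ∑ j, x j ^ 2) : ‖toC A‖ ^ 2 ≤ c := by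
  refine (pow_le_pow_left₀ (norm_nonneg _)
    (l2_opNorm_le_of_sum_sq_le (toC A) (Real.sqrt_nonneg c) fun x => ?_) 2).trans_eq
    (Real.sq_sqrt hc)
  have e : ∀ i, ‖(toC A *ᵥ x) i‖ ^ 2 =
      (A *ᵥ fun j => (x j).re) i ^ 2 + (A *ᵥ fun j => (x j).im) i ^ 2 := fun i => by
    rw [Complex.sq_norm, Complex.normSq_apply]
    simp [toC, Matrix.mulVec, dotProduct, pow_two]
  have e2 : ∀ j, ‖x j‖ ^ 2 = (x j).re ^ 2 + (x j).im ^ 2 := fun j => by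
    rw [Complex.sq_norm, Complex.normSq_apply]; ring
  simp_rw [e, e2, Finset.sum_add_distrib, mul_add, Real.sq_sqrt hc]
  exact add_le_add (h _) (h _)

theorem l2_opNorm_sq {m n : Type*} [Fintype m] [Fintype n] [DecidableEq n] (A : Matrix m n ℂ) :
    ‖A‖ ^ 2 = ‖Aᴴ * A‖ := by
  rw [Matrix.l2_opNorm_conjTranspose_mul_self, pow_two]

theorem l2_opNorm_sq' {m n : Type*} [Fintype m] [Fintype n] [DecidableEq m] [DecidableEq n]
    (A : Matrix m n ℂ) : ‖A‖ ^ 2 = ‖A * Aᴴ‖ := by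
  rw [← Matrix.l2_opNorm_conjTranspose, l2_opNorm_sq, Matrix.conjTranspose_conjTranspose]

/-- The product of `(A | B)` with its adjoint is `A Aᴴ + B Bᴴ`; the triangle inequality applies. -/
theorem l2_opNorm_fromCols_sq_le {m n o : Type*} [Fintype m] [Fintype n] [Fintype o]
    [DecidableEq m] [DecidableEq n] [DecidableEq o] (A : Matrix m n ℂ) (B : Matrix m o ℂ) :
    ‖Matrix.fromCols A B‖ ^ 2 ≤ ‖A‖ ^ 2 + ‖B‖ ^ 2 := by
  rw [l2_opNorm_sq', l2_opNorm_sq' A, l2_opNorm_sq' B,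
    Matrix.conjTranspose_fromCols_eq_fromRows_conjTranspose, Matrix.fromCols_mul_fromRows]
  exact norm_add_le _ _

/-! ### Block-encodings by unitary dilation -/

theorem submatrix_one_mul_mul_conjTranspose {m P : Type*} [Fintype P] [DecidableEq P] (f : m → P)
    (A : Matrix P P ℂ) :
    (1 : Matrix P P ℂ).submatrix f id * A * ((1 : Matrix P P ℂ).submatrix f id)ᴴ =
      A.submatrix f f := by
  ext i j
  simp [Matrix.mul_apply, Matrix.one_apply]

section Dilation

variable {n : Type*} [Fintype n] [DecidableEq n]

open scoped MatrixOrder ComplexOrder in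
/-- A Hermitian contraction is a corner of a unitary matrix of twice its order. -/
theorem exists_unitary_fromBlocks {T : Matrix n n ℂ} (hT : T.IsHermitian) (h1 : ‖T‖ ≤ 1) :
    ∃ Q : Matrix n n ℂ, Matrix.fromBlocks T Q Q T ∈ Matrix.unitaryGroup (n ⊕ n) ℂ := by
  -- `u = T + i √(1 - T²)` is unitary. Its second summand `Q` is skew-Hermitian, and comparing `u u*
  -- = 1` with `u* u = 1` shows that it commutes with `T`.
  let u := selfAdjoint.unitarySelfAddISMul (⟨T, hT⟩ : selfAdjoint (Matrix n n ℂ)) h1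
  set Q : Matrix n n ℂ := (u : Matrix n n ℂ) - T with hQ
  have hu : (u : Matrix n n ℂ) = T + Q := by rw [hQ]; abel
  have hre : (u : Matrix n n ℂ) + star (u : Matrix n n ℂ) = T + T := by
    have h2 : star (u : Matrix n n ℂ) = T - Complex.I • CFC.sqrt (1 - T ^ 2) :=
      selfAdjoint.star_coe_unitarySelfAddISMul (⟨T, hT⟩ : selfAdjoint (Matrix n n ℂ)) h1
    have h3 : (u : Matrix n n ℂ) = T + Complex.I • CFC.sqrt (1 - T ^ 2) := rfl
    rw [h2, h3]
    abel
  have hsu : star (u : Matrix n n ℂ) = T - Q := by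
    rw [hQ, ← add_right_inj (u : Matrix n n ℂ), hre]; abel
  have hsT : Tᴴ = T := hT
  have hsQ : Qᴴ = -Q := by
    have : Qᴴ = star (u : Matrix n n ℂ) - Tᴴ := by rw [hQ, Matrix.conjTranspose_sub]; rfl
    rw [this, hsu, hsT]; abel
  have p1 : (T + Q) * (T - Q) = 1 := by rw [← hu, ← hsu]; exact Unitary.coe_mul_star_self u
  have p2 : (T - Q) * (T + Q) = 1 := by rw [← hu, ← hsu]; exact Unitary.coe_star_mul_self u
  have q1 : T * T - T * Q + Q * T - Q * Q = 1 := by rw [← p1]; noncomm_ring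
  have q2 : T * T + T * Q - Q * T - Q * Q = 1 := by rw [← p2]; noncomm_ring
  have c1 : T * Q = Q * T := by
    have h3 : (2 : ℂ) • (T * Q - Q * T) = 0 := by
      have h4 := sub_eq_zero.2 (q2.trans q1.symm)
      rw [← h4, two_smul]; abel
    exact sub_eq_zero.1 ((smul_eq_zero.1 h3).resolve_left two_ne_zero)
  have c2 : T * T - Q * Q = 1 := by rw [← q1, c1]; abel
  refine ⟨Q, Matrix.mem_unitaryGroup_iff.2 ?_⟩
  rw [Matrix.star_eq_conjTranspose, Matrix.fromBlocks_conjTranspose, hsT, hsQ,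
    Matrix.fromBlocks_multiply, ← Matrix.fromBlocks_one]
  congr 1
  · rw [← c2, mul_neg, sub_eq_add_neg]
  · rw [mul_neg, c1]; abel
  · rw [mul_neg, c1]; abel
  · rw [← c2, mul_neg, sub_eq_add_neg, add_comm]

/-- A Hermitian matrix has a block-encoding with any normalization factor that is not less than
its norm. -/
theorem exists_blockEncoding {M : Matrix n n ℂ} (hM : M.IsHermitian) {α : ℝ} (hα : ‖M‖ ≤ α) :
    ∃ E : BlockEncoding M, E.α = α := by
  have hα0 : 0 ≤ α := (norm_nonneg _).trans hα
  set T : Matrix n n ℂ := (α⁻¹ : ℝ) • M with hTdef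
  have hT : T.IsHermitian := by
    rw [Matrix.IsHermitian, hTdef, Matrix.conjTranspose_smul, hM.eq, star_trivial]
  have hT1 : ‖T‖ ≤ 1 := by
    rw [hTdef, norm_smul, Real.norm_eq_abs, abs_of_nonneg (inv_nonneg.2 hα0)]
    rcases hα0.eq_or_lt with h | h
    · rw [← h]; simp
    · rw [inv_mul_le_iff₀ h, mul_one]; exact hα
  -- For `α = 0` the convention `0⁻¹ = 0` gives `T = 0`, which is consistent since then `M = 0`.
  have hMT : M = (α : ℂ) • T := by
    rcases hα0.eq_or_lt with h | h
    · have : M = 0 := norm_eq_zero.1 (le_antisymm (hα.trans h.symm.le) (norm_nonneg _))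
      rw [hTdef, this, smul_zero, smul_zero]
    · rw [hTdef, Complex.coe_smul, smul_inv_smul₀ h.ne']
  obtain ⟨Q, hW⟩ := exists_unitary_fromBlocks hT hT1
  -- Any `p` with `2 ^ p` at least the order of the dilation would do; the remaining dimensions are
  -- padded by an identity block.
  set p := Fintype.card (n ⊕ n)
  have hp : p ≤ 2 ^ p := Nat.lt_two_pow_self.le
  have hcard : Fintype.card (Fin (2 ^ p)) = Fintype.card ((n ⊕ n) ⊕ Fin (2 ^ p - p)) := by
    rw [Fintype.card_sum, Fintype.card_fin, Fintype.card_fin]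
    change _ = p + _
    omega
  let e := Fintype.equivOfCardEq hcard
  let f : n → Fin (2 ^ p) := fun i => e.symm (Sum.inl (Sum.inl i))
  have hf : Function.Injective f := fun i j h =>
    Sum.inl_injective (Sum.inl_injective (e.symm.injective h))
  let U₀ : Matrix ((n ⊕ n) ⊕ Fin (2 ^ p - p)) ((n ⊕ n) ⊕ Fin (2 ^ p - p)) ℂ :=
    Matrix.fromBlocks (Matrix.fromBlocks T Q Q T) 0 0 1
  have hU₀ : U₀ * U₀ᴴ = 1 := by
    have := Matrix.mem_unitaryGroup_iff.1 hW
    rw [Matrix.star_eq_conjTranspose] at this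
    rw [Matrix.fromBlocks_conjTranspose, Matrix.fromBlocks_multiply, this,
      ← Matrix.fromBlocks_one]
    simp
  have horth : (1 : Matrix (Fin (2 ^ p)) (Fin (2 ^ p)) ℂ).submatrix f id *
      ((1 : Matrix (Fin (2 ^ p)) (Fin (2 ^ p)) ℂ).submatrix f id)ᴴ = 1 := by
    have := submatrix_one_mul_mul_conjTranspose f 1
    rwa [Matrix.mul_one, Matrix.submatrix_one f hf] at this
  refine ⟨{
    p := p
    U := U₀.submatrix e e
    α := α
    rowProj := (1 : Matrix (Fin (2 ^ p)) (Fin (2 ^ p)) ℂ).submatrix f id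
    colProj := (1 : Matrix (Fin (2 ^ p)) (Fin (2 ^ p)) ℂ).submatrix f id
    rowNOT := _
    colNOT := _
    unitary := ?_
    rowProj_orthonormal := horth
    colProj_orthonormal := horth
    rowNOT_eq := rfl
    colNOT_eq := rfl
    norm_le := hα
    encodes := ?_ }, rfl⟩
  · rw [Matrix.mem_unitaryGroup_iff, Matrix.star_eq_conjTranspose, Matrix.conjTranspose_submatrix,
      Matrix.submatrix_mul_equiv, hU₀, Matrix.submatrix_one_equiv]
  · rw [submatrix_one_mul_mul_conjTranspose, hMT]
    congr 1
    ext i j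
    simp [f, U₀]

end Dilation

/-! ### Factorization of the coefficient matrix -/

theorem Matrix.PosDef.exists_transpose_mul_self {n : Type*} [Fintype n] [DecidableEq n]
    {A : Matrix n n ℝ} (hA : A.PosDef) : ∃ B : Matrix n n ℝ, A = Bᵀ * B ∧ B * B⁻¹ = 1 := by
  open scoped MatrixOrder in
  obtain ⟨B, hB⟩ := CStarAlgebra.nonneg_iff_eq_star_mul_self.1 hA.posSemidef.nonneg
  have hB' : A = Bᵀ * B := by
    rw [hB, Matrix.star_eq_conjTranspose, Matrix.conjTranspose_eq_transpose_of_trivial]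
  refine ⟨B, hB', Matrix.mul_nonsing_inv _ ?_⟩
  have h := hA.det_pos
  rw [hB', Matrix.det_mul] at h
  exact isUnit_iff_ne_zero.2 fun h0 => by simp [h0] at h

/-- The factorization is done block by block. The inverse `B'` recovers a matrix `X` from `(B ⊗ 1)
X`, which yields the lower norm bound. -/
theorem DDGeometry.exists_coeffMatrix_eq {d : ℕ} {G : DDGeometry d}
    {ρK : G.Cell → Matrix (Fin d) (Fin d) ℝ} (hpos : ∀ K, (ρK K).PosDef) :
    ∃ B B' : Matrix (Fin d × G.Cell) (Fin d × G.Cell) ℝ,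
      G.coeffMatrix ρK = Bᵀ * B ∧ B * B' = 1 := by
  choose b hb hb' using fun K => (hpos K).exists_transpose_mul_self
  refine ⟨Matrix.blockDiagonal b, Matrix.blockDiagonal fun K => (b K)⁻¹, ?_, ?_⟩
  · rw [Matrix.blockDiagonal_transpose, ← Matrix.blockDiagonal_mul, DDGeometry.coeffMatrix]
    exact congrArg _ (funext hb)
  · rw [← Matrix.blockDiagonal_mul, ← Matrix.blockDiagonal_one]
    exact congrArg _ (funext hb')

/-! ### The preconditioned matrix -/

namespace DDGeometry

variable {d : ℕ} {G : DDGeometry d} {ψ : G.Cell → Fin (2 ^ d) → (Fin d → ℝ) → ℝ} {k q : ℕ}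

theorem gradMatrix_mul_schwarzFactor (Z : Matrix G.Vertex (Fin k) ℝ)
    (F₀ : Matrix (Fin k) (Fin q) ℝ) : G.gradMatrix ψ * G.schwarzFactor Z F₀ =
      Matrix.fromCols (G.gradMatrix ψ * G.localFactor) (G.gradMatrix ψ * Z * F₀) := by
  rw [Matrix.mul_assoc, ← Matrix.mul_fromCols]
  rfl

/-- The norm of the gradient of the Schwarz factor is bounded above by the number of subdomains
and levels. -/
theorem norm_gradMatrix_mul_schwarzFactor_sq_le (h : G.IsDGBasis ψ)
    (Z : Matrix G.Vertex (Fin k) ℝ) (F₀ : Matrix (Fin k) (Fin q) ℝ) :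
    ‖toC (G.gradMatrix ψ * G.schwarzFactor Z F₀)‖ ^ 2 ≤
      4 * G.numSub * d * G.L + ‖toC (G.gradMatrix ψ * Z * F₀)‖ ^ 2 := by
  rw [gradMatrix_mul_schwarzFactor, toC_fromCols]
  refine (l2_opNorm_fromCols_sq_le _ _).trans (add_le_add_left ?_ _)
  refine toC_norm_sq_le _ (by positivity) fun c => ?_
  rw [← Matrix.mulVec_mulVec]
  exact sum_sq_gradMatrix_localFactor_le h c

/-- Coarse vectors are extended by zero to the local columns. -/
theorem norm_coarse_le (Z : Matrix G.Vertex (Fin k) ℝ) (F₀ : Matrix (Fin k) (Fin q) ℝ) :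
    ‖toC (G.gradMatrix ψ * Z * F₀)‖ ^ 2 ≤
      ‖toC (G.gradMatrix ψ * G.schwarzFactor Z F₀)‖ ^ 2 := by
  refine toC_norm_sq_le _ (by positivity) fun x => ?_
  have := sum_sq_mulVec_le_toC (G.gradMatrix ψ * G.schwarzFactor Z F₀) (Sum.elim 0 x)
  rw [Fintype.sum_sum_type] at this
  simpa [gradMatrix_mul_schwarzFactor, Matrix.fromCols_mulVec_sumElim] using this

theorem le_norm_gradMatrix_mul_schwarzFactor_sq (h : G.IsDGBasis ψ) (s : Fin d)
    (Z : Matrix G.Vertex (Fin k) ℝ) (F₀ : Matrix (Fin k) (Fin q) ℝ) :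
    4 * (G.L / (G.L + 2 ^ d)) ≤ ‖toC (G.gradMatrix ψ * G.schwarzFactor Z F₀)‖ ^ 2 := by
  obtain ⟨c, hc, hle⟩ := exists_le_sum_sq_gradMatrix_localFactor h s
  have := sum_sq_mulVec_le_toC (G.gradMatrix ψ * G.schwarzFactor Z F₀) (Sum.elim c 0)
  rw [Fintype.sum_sum_type] at this
  simp only [gradMatrix_mul_schwarzFactor, Matrix.fromCols_mulVec_sumElim, Sum.elim_inl,
    Sum.elim_inr, Matrix.mulVec_zero, add_zero, Pi.zero_apply, ← Matrix.mulVec_mulVec,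
    ne_eq, OfNat.ofNat_ne_zero, not_false_eq_true, zero_pow, Finset.sum_const_zero] at this
  rw [← gradMatrix_mul_schwarzFactor] at this
  exact le_of_mul_le_mul_right (hle.trans this) hc

variable {ρ : (Fin d → ℝ) → Matrix (Fin d) (Fin d) ℝ} {ρK : G.Cell → Matrix (Fin d) (Fin d) ℝ}

/-- A factorization of the coefficient matrix yields one of the stiffness matrix. -/
theorem stiffness_eq_transpose_mul_self (h : G.IsDGBasis ψ)
    (hρ : ∀ K, ∀ x ∈ G.cellSet K, ρ x = ρK K) (hpos : ∀ K, (ρK K).PosDef)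
    {B : Matrix (Fin d × G.Cell) (Fin d × G.Cell) ℝ} (hB : G.coeffMatrix ρK = Bᵀ * B) :
    G.stiffness ρ =
      (B ⊗ₖ (1 : Matrix (Fin (2 ^ d)) (Fin (2 ^ d)) ℝ) * G.gradMatrix ψ)ᵀ *
        (B ⊗ₖ (1 : Matrix (Fin (2 ^ d)) (Fin (2 ^ d)) ℝ) * G.gradMatrix ψ) := by
  have hsymm : ∀ K, (ρK K)ᵀ = ρK K := fun K => by
    have := (hpos K).1
    rwa [Matrix.IsHermitian, Matrix.conjTranspose_eq_transpose_of_trivial] at this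
  have hk : (B ⊗ₖ (1 : Matrix (Fin (2 ^ d)) (Fin (2 ^ d)) ℝ))ᵀ = Bᵀ ⊗ₖ 1 := by
    rw [← Matrix.kroneckerMap_transpose, Matrix.transpose_one]
  rw [stiffness_eq h hρ hsymm, hB, Matrix.transpose_mul, hk, Matrix.mul_assoc, Matrix.mul_assoc,
    ← Matrix.mul_assoc (Bᵀ ⊗ₖ _), ← Matrix.mul_kronecker_mul, Matrix.one_mul]

/-- The preconditioned matrix is spectrally equivalent to the Gram matrix of the gradient of the
Schwarz factor. -/
theorem norm_preconditioned (h : G.IsDGBasis ψ) (hρ : ∀ K, ∀ x ∈ G.cellSet K, ρ x = ρK K)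
    (hpos : ∀ K, (ρK K).PosDef) {n : Type*} [Fintype n] [DecidableEq n]
    (F : Matrix G.Vertex n ℝ) :
    (toC (Fᵀ * G.stiffness ρ * F)).IsHermitian ∧
    ‖toC (Fᵀ * G.stiffness ρ * F)‖ ≤
      ‖toC (G.coeffMatrix ρK)‖ * ‖toC (G.gradMatrix ψ * F)‖ ^ 2 ∧
    ‖toC (G.gradMatrix ψ * F)‖ ^ 2 ≤
      ‖(toC (G.coeffMatrix ρK))⁻¹‖ * ‖toC (Fᵀ * G.stiffness ρ * F)‖ := by
  obtain ⟨B, B', hB, hBB⟩ := exists_coeffMatrix_eq hpos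
  set X := toC (G.gradMatrix ψ * F)
  set b := toC B with hb
  set b' := toC B' with hb'
  set Y := (b ⊗ₖ (1 : Matrix (Fin (2 ^ d)) (Fin (2 ^ d)) ℂ)) * X with hY
  have hM : toC (Fᵀ * G.stiffness ρ * F) = Yᴴ * Y := by
    have e : Fᵀ * G.stiffness ρ * F =
        ((B ⊗ₖ (1 : Matrix (Fin (2 ^ d)) (Fin (2 ^ d)) ℝ)) * (G.gradMatrix ψ * F))ᵀ *
          ((B ⊗ₖ (1 : Matrix (Fin (2 ^ d)) (Fin (2 ^ d)) ℝ)) * (G.gradMatrix ψ * F)) := by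
      rw [stiffness_eq_transpose_mul_self h hρ hpos hB]
      simp only [Matrix.transpose_mul]
      simp only [Matrix.mul_assoc]
    rw [e, toC_mul, toC_transpose, toC_mul, toC_kronecker_one]
  have hbb : b * b' = 1 := by rw [hb, hb', ← toC_mul, hBB, toC_one]
  have hb'b : b' * b = 1 := mul_eq_one_comm.1 hbb
  have hD : toC (G.coeffMatrix ρK) = bᴴ * b := by rw [hB, toC_mul, toC_transpose]
  have hDinv : (toC (G.coeffMatrix ρK))⁻¹ = b' * b'ᴴ := by
    refine Matrix.inv_eq_right_inv ?_
    rw [hD, Matrix.mul_assoc, ← Matrix.mul_assoc b, hbb, Matrix.one_mul,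
      ← Matrix.conjTranspose_mul, hb'b, Matrix.conjTranspose_one]
  have hX : X = (b' ⊗ₖ (1 : Matrix (Fin (2 ^ d)) (Fin (2 ^ d)) ℂ)) * Y := by
    rw [hY, ← Matrix.mul_assoc, ← Matrix.mul_kronecker_mul, hb'b, Matrix.one_mul,
      Matrix.one_kronecker_one, Matrix.one_mul]
  have bound : ∀ (c : Matrix (Fin d × G.Cell) (Fin d × G.Cell) ℂ)
      (W : Matrix ((Fin d × G.Cell) × Fin (2 ^ d)) n ℂ),
      ‖(c ⊗ₖ (1 : Matrix (Fin (2 ^ d)) (Fin (2 ^ d)) ℂ)) * W‖ ^ 2 ≤ ‖c‖ ^ 2 * ‖W‖ ^ 2 := by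
    intro c W
    rw [← mul_pow]
    exact pow_le_pow_left₀ (norm_nonneg _) ((Matrix.l2_opNorm_mul _ _).trans
      (mul_le_mul_of_nonneg_right (l2_opNorm_kronecker_one_le c) (norm_nonneg _))) 2
  refine ⟨by rw [hM]; exact Matrix.isHermitian_conjTranspose_mul_self Y, ?_, ?_⟩
  · rw [hM, ← l2_opNorm_sq, hD, ← l2_opNorm_sq]
    exact bound b X
  · rw [hM, ← l2_opNorm_sq, hDinv, ← l2_opNorm_sq']
    calc ‖X‖ ^ 2 = _ := by rw [hX]
      _ ≤ _ := bound b' Y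

/-- The coarse component does not vanish. -/
theorem norm_coarse_pos (h : G.IsDGBasis ψ) (hρ : ∀ K, ∀ x ∈ G.cellSet K, ρ x = ρK K)
    (hpos : ∀ K, (ρK K).PosDef) (s : Fin d) (hk : 1 ≤ k) {Z : Matrix G.Vertex (Fin k) ℝ}
    (hZ : LinearIndependent ℝ Z.col) {F₀ : Matrix (Fin k) (Fin q) ℝ}
    (hF : (Zᵀ * G.stiffness ρ * Z)⁻¹ = F₀ * F₀ᵀ) : 0 < ‖toC (G.gradMatrix ψ * Z * F₀)‖ := by
  obtain ⟨B, B', hB, hBB⟩ := exists_coeffMatrix_eq hpos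
  have hB'B : B' * B = 1 := mul_eq_one_comm.1 hBB
  set B₁ := B ⊗ₖ (1 : Matrix (Fin (2 ^ d)) (Fin (2 ^ d)) ℝ) with hB₁
  have hB₁inv : (B' ⊗ₖ (1 : Matrix (Fin (2 ^ d)) (Fin (2 ^ d)) ℝ)) * B₁ = 1 := by
    rw [hB₁, ← Matrix.mul_kronecker_mul, hB'B, Matrix.one_mul, Matrix.one_kronecker_one]
  set Y := B₁ * (G.gradMatrix ψ * Z) with hY
  have hA : Zᵀ * G.stiffness ρ * Z = Yᴴ * Y := by
    rw [stiffness_eq_transpose_mul_self h hρ hpos hB, ← hB₁, hY,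
      Matrix.conjTranspose_eq_transpose_of_trivial]
    simp only [Matrix.transpose_mul]
    simp only [Matrix.mul_assoc]
  have hYinj : Function.Injective Y.mulVec := by
    refine (injective_iff_map_eq_zero Y.mulVecLin).2 fun x hx => ?_
    rw [Matrix.mulVecLin_apply] at hx
    have h1 : (G.gradMatrix ψ * Z) *ᵥ x = 0 := by
      rw [← Matrix.one_mulVec ((G.gradMatrix ψ * Z) *ᵥ x), ← hB₁inv, ← Matrix.mulVec_mulVec,
        Matrix.mulVec_mulVec x B₁, ← hY, hx, Matrix.mulVec_zero]
    rw [← Matrix.mulVec_mulVec] at h1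
    have h2 := gradMatrix_mulVec_injective h s h1
    exact Matrix.mulVec_injective_iff.2 hZ (h2.trans (Matrix.mulVec_zero Z).symm)
  have hdet : IsUnit (Yᴴ * Y).det :=
    (Matrix.isUnit_iff_isUnit_det _).1 (Matrix.PosDef.conjTranspose_mul_self Y hYinj).isUnit
  rw [norm_pos_iff]
  intro h0
  have h0' : G.gradMatrix ψ * Z * F₀ = 0 := by
    ext i j
    have := congrFun (congrFun h0 i) j
    simpa [toC] using this
  -- If `C Z F₀` vanished, the invertible coarse matrix times its inverse `F₀ F₀ᵀ` would be zero,
  -- which is impossible because `1 ≤ k`.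
  have h1 := Matrix.mul_nonsing_inv _ hdet
  rw [← hA, hF, hA, hY, ← Matrix.mul_assoc, Matrix.mul_assoc _ _ F₀, Matrix.mul_assoc B₁, h0',
    Matrix.mul_zero, Matrix.mul_zero, Matrix.zero_mul] at h1
  have := congrFun (congrFun h1 ⟨0, hk⟩) ⟨0, hk⟩
  simp at this

end DDGeometry

end

/-! ### The block-encoding theorem -/

theorem mainTheorem4 (d : ℕ) (hd : 1 ≤ d) :
    ∃ Cd : ℝ, ∀ (G : DDGeometry d)
      -- the diffusion coefficient, with the value `ρK K` on the element `K`
      (ρ : (Fin d → ℝ) → Matrix (Fin d) (Fin d) ℝ)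
      (ρK : G.Cell → Matrix (Fin d) (Fin d) ℝ)
      (_ : ∀ K, ∀ x ∈ G.cellSet K, ρ x = ρK K)
      (_ : ∀ K, (ρK K).PosDef)
      -- the orthonormal bases of the discontinuous space
      (ψ : G.Cell → Fin (2 ^ d) → (Fin d → ℝ) → ℝ) (_ : G.IsDGBasis ψ)
      -- a basis of the coarse space, and a factorization of the coarse solve
      (k q : ℕ) (_ : 1 ≤ k)
      (Z : Matrix G.Vertex (Fin k) ℝ) (_ : LinearIndependent ℝ Z.col)
      (F₀ : Matrix (Fin k) (Fin q) ℝ)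
      (_ : (Zᵀ * G.stiffness ρ * Z)⁻¹ = F₀ * F₀ᵀ)
      (UD : BlockEncoding (toC (G.coeffMatrix ρK)))
      (UZ : BlockEncoding (toC (G.gradMatrix ψ * Z * F₀))),
      ∃ U : BlockEncoding
          (toC ((G.schwarzFactor Z F₀)ᵀ * G.stiffness ρ * G.schwarzFactor Z F₀)),
        U.α = UD.α * (4 * G.numSub * d * G.L + UZ.α ^ 2) ∧
        U.subnorm ≤ condNumber (toC (G.coeffMatrix ρK)) * UD.subnorm *
          (G.numSub * d * (G.L + Cd) + UZ.subnorm ^ 2) := by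
  refine ⟨2 ^ d, ?_⟩
  intro G ρ ρK hρ hpos ψ hψ k q hk Z hZ F₀ hF UD UZ
  obtain ⟨hherm, hup, hlow⟩ :=
    DDGeometry.norm_preconditioned hψ hρ hpos (G.schwarzFactor Z F₀)
  have hgup := DDGeometry.norm_gradMatrix_mul_schwarzFactor_sq_le hψ Z F₀
  have hglow := DDGeometry.le_norm_gradMatrix_mul_schwarzFactor_sq hψ ⟨0, hd⟩ Z F₀
  have hgz := DDGeometry.norm_coarse_le (ψ := ψ) Z F₀
  have hz := DDGeometry.norm_coarse_pos hψ hρ hpos ⟨0, hd⟩ hk hZ hF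
  have hαD := UD.norm_le
  have hαZ := UZ.norm_le
  unfold BlockEncoding.subnorm condNumber
  generalize UD.α = αD at hαD ⊢
  generalize UZ.α = αZ at hαZ ⊢
  set M := toC ((G.schwarzFactor Z F₀)ᵀ * G.stiffness ρ * G.schwarzFactor Z F₀)
  set g := ‖toC (G.gradMatrix ψ * G.schwarzFactor Z F₀)‖
  set z := ‖toC (G.gradMatrix ψ * Z * F₀)‖
  set D := toC (G.coeffMatrix ρK)
  have hL : (1 : ℝ) ≤ G.L := by exact_mod_cast G.one_le_L
  have hz2 : 0 < z ^ 2 := by positivity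
  have hsum : g ^ 2 ≤ 4 * G.numSub * d * G.L + αZ ^ 2 :=
    hgup.trans (add_le_add_right (pow_le_pow_left₀ hz.le hαZ 2) _)
  obtain ⟨U, hU⟩ := exists_blockEncoding hherm
    (α := αD * (4 * G.numSub * d * G.L + αZ ^ 2))
    (hup.trans (mul_le_mul hαD hsum (by positivity) ((norm_nonneg _).trans hαD)))
  refine ⟨U, hU, ?_⟩
  rw [hU]
  -- A zero norm would force `g ^ 2 ≤ 0`, against `0 < z ^ 2 ≤ g ^ 2`; the quotients by norms are
  -- therefore genuine.
  have hm : 0 < ‖M‖ := by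
    rcases (norm_nonneg M).eq_or_lt with h0 | h0
    · rw [← h0, mul_zero] at hlow; linarith
    · exact h0
  have hDpos : 0 < ‖D‖ := by
    rcases (norm_nonneg D).eq_or_lt with h0 | h0
    · rw [← h0, zero_mul] at hup; linarith
    · exact h0
  have e : ‖D‖ * ‖D⁻¹‖ * (αD / ‖D‖) = αD * ‖D⁻¹‖ := by field_simp
  rw [e, div_le_iff₀ hm]
  -- The two summands of the normalization factor are compared with `g ^ 2` separately: the local
  -- one by the oscillating test vector, the coarse one by `z ≤ g`.
  have hlocal : (4 * G.numSub * d * G.L : ℝ) ≤ g ^ 2 * (G.numSub * d * (G.L + 2 ^ d)) := by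
    have hpos' : (0 : ℝ) < G.L + 2 ^ d := by positivity
    calc (4 * G.numSub * d * G.L : ℝ) =
        4 * (G.L / (G.L + 2 ^ d)) * (G.numSub * d * (G.L + 2 ^ d)) := by field_simp
      _ ≤ _ := mul_le_mul_of_nonneg_right hglow (by positivity)
  have hcoarse : αZ ^ 2 ≤ g ^ 2 * (αZ / z) ^ 2 := by
    calc αZ ^ 2 = z ^ 2 * (αZ / z) ^ 2 := by field_simp
      _ ≤ _ := mul_le_mul_of_nonneg_right hgz (sq_nonneg _)
  calc αD * (4 * G.numSub * d * G.L + αZ ^ 2 : ℝ)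
      ≤ αD * (‖D⁻¹‖ * ‖M‖ * (G.numSub * d * (G.L + 2 ^ d) + (αZ / z) ^ 2)) := by
        refine mul_le_mul_of_nonneg_left (le_trans ?_ (mul_le_mul_of_nonneg_right hlow
          (by positivity))) ((norm_nonneg _).trans hαD)
        rw [mul_add]
        exact add_le_add hlocal hcoarse
    _ = _ := by ring
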